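/- **Definitions.** A *point set* is a finite set $P\subset\mathbf R^2$ no three points of which are aligned. Two point sets have the same *order type* if there is a bijection between them that preserves the orientation (clockwise or counter-clockwise) of every triple of pairwise distinct points; an order type $\omega$ is an equivalence class for this relation, and $|\omega|$ is the cardinality of any point set in it. Let $\mathcal O$ be the set of all order types. For a Borel probability measure $\mu$ on $\mathbf R^2$ and $\omega\in\mathcal O$, let $\ell_\mu(\omega)$ be the probability that $|\omega|$ random points sampled independently from $\mu$ form a point set of order type $\omega$. For $t\in(0,1)$, let $\odot_t$ be the probability measure supported on the two circles of radii $1$ and $t$ centred at the origin, where each circle has measure $1/2$, distributed proportionally to arc length. **Proposition.** The sequence $(\ell_{\odot_{1/n}})_{n\ge 2}$ has a subsequence that converges pointwise on $\mathcal O$. If $\ell_\odot\colon\mathcal O\to\mathbf R$ is the pointwise limit of any such convergent subsequence, then there exists no Borel probability measure $\mu$ on $\mathbf R^2$ such that $\ell_\mu=\ell_\odot$. -/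

import Mathlib

open MeasureTheory Filter Topology

namespace PlanarOrder

/-- The Euclidean plane, with its Borel `σ`-algebra. -/
abbrev Plane : Type := EuclideanSpace ℝ (Fin 2)

/-- Orientation of the triangle `pqr`: `1` if it is counter-clockwise, `-1` if it is clockwise,
`0` if the three points are aligned. -/
noncomputable def orient (p q r : Plane) : SignType :=
  SignType.sign ((q 0 - p 0) * (r 1 - p 1) - (q 1 - p 1) * (r 0 - p 0))

/-- A finite set of points of the plane, no three of which are aligned. -/
structure IsPointSet (P : Set Plane) : Prop where
  finite : P.Finite
  not_aligned : ∀ p ∈ P, ∀ q ∈ P, ∀ r ∈ P, p ≠ q → p ≠ r → q ≠ r → orient p q r ≠ 0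

/-- `P` and `Q` have the same order type: some bijection preserves the orientations of
all triples of pairwise distinct points. -/
def SameOrderType (P Q : Set Plane) : Prop :=
  ∃ f : P ≃ Q, ∀ p q r : P, p ≠ q → p ≠ r → q ≠ r →
    orient (f p) (f q) (f r) = orient p q r

theorem SameOrderType.refl (P : Set Plane) : SameOrderType P P :=
  ⟨Equiv.refl P, fun _ _ _ _ _ _ => rfl⟩

theorem SameOrderType.symm {P Q : Set Plane} (h : SameOrderType P Q) : SameOrderType Q P := by
  obtain ⟨f, hf⟩ := h
  refine ⟨f.symm, fun p q r hpq hpr hqr => ?_⟩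
  have := hf (f.symm p) (f.symm q) (f.symm r) (f.symm.injective.ne hpq)
    (f.symm.injective.ne hpr) (f.symm.injective.ne hqr)
  simpa using this.symm

theorem SameOrderType.trans {P Q R : Set Plane} (h : SameOrderType P Q)
    (h' : SameOrderType Q R) : SameOrderType P R := by
  obtain ⟨f, hf⟩ := h
  obtain ⟨g, hg⟩ := h'
  refine ⟨f.trans g, fun p q r hpq hpr hqr => ?_⟩
  exact (hg (f p) (f q) (f r) (f.injective.ne hpq) (f.injective.ne hpr)
    (f.injective.ne hqr)).trans (hf p q r hpq hpr hqr)

/-- Having the same order type, as an equivalence relation on point sets. -/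
instance pointSetSetoid : Setoid {P : Set Plane // IsPointSet P} where
  r P Q := SameOrderType P.1 Q.1
  iseqv := ⟨fun P => SameOrderType.refl P.1, fun h => h.symm, fun h h' => h.trans h'⟩

/-- An order type: an equivalence class of point sets. -/
def OType : Type := Quotient pointSetSetoid

/-- The size of an order type: the cardinality of any of its realizations. -/
noncomputable def OType.size (ω : OType) : ℕ :=
  Quotient.lift (s := pointSetSetoid)
    (fun P : {P : Set Plane // IsPointSet P} => Nat.card P.1)
    (fun P Q (h : SameOrderType P.1 Q.1) => Nat.card_congr h.choose) ω

/-- The set `P` is a realization of the order type `ω`. -/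
def Realizes (P : Set Plane) (ω : OType) : Prop :=
  ∃ h : IsPointSet P, (Quotient.mk pointSetSetoid ⟨P, h⟩ : OType) = ω

/-- The map `ℓ_μ`: the probability that `|ω|` points sampled independently from `μ` form a set
of order type `ω`. (A sample in which two points coincide is a set of less than `|ω|`
points, so it does not realize `ω`.) -/
noncomputable def ell (μ : Measure Plane) (ω : OType) : ℝ :=
  (Measure.pi (fun _ : Fin ω.size => μ)).real
    {x : Fin ω.size → Plane | Realizes (Set.range x) ω}

/-- The uniform (arc length) probability distribution on the circle of radius `r` centred at the
origin. -/
noncomputable def circleUnif (r : ℝ) : Measure Plane :=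
  Measure.map (fun θ : ℝ => (!₂[r * Real.cos θ, r * Real.sin θ] : Plane))
    ((ENNReal.ofReal (2 * Real.pi))⁻¹ • volume.restrict (Set.Ioc 0 (2 * Real.pi)))

/-- The distribution `⊙_t` on two concentric circles of radii `1` and `t`, each of
measure `1/2`. -/
noncomputable def odot (t : ℝ) : Measure Plane :=
  (2⁻¹ : ENNReal) • circleUnif 1 + (2⁻¹ : ENNReal) • circleUnif t

/-- `ℓ` is the (pointwise) limit of a convergent subsequence of `(ℓ_{⊙_{1/n}})`, `n ≥ 2`. -/
def IsOdotLimit (l : OType → ℝ) : Prop :=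
  ∃ φ : ℕ → ℕ, StrictMono φ ∧ (∀ k, 2 ≤ φ k) ∧
    ∀ ω : OType, Tendsto (fun k => ell (odot (1 / (φ k : ℝ))) ω) atTop (𝓝 (l ω))

end PlanarOrder

/-! Existence of a limit is compactness: there are countably many order types and each `ell` takes
values in `[0, 1]`.

For the second claim, let `t` tend to `0`. Almost surely the signs of the areas of a sample from
`odot t` stabilise to those of `limArea`, evaluated on independent labeled uniform angles. In this
limit model an outer point is at infinity for the inner points, and the inner points all sit at the
origin for a pair of outer points. If `ell μ` were the limit, samples from `μ` and from the model
would have the same law of orientations (`pi_chir_eq_model`).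

Equality of laws also transfers statements of the form "almost every configuration in `d` has, with
positive probability, a one-point extension in `C`" (`pos_extension_of_law_eq`). In the model, take
two outer points `x`, `y` and inner points `p`, `q`. With positive probability an outer point `z`
makes `xyz` surround the origin; then `p` is inside `xyz` and neither `xz` nor `yz` separates `p`
from `q` (`model_extension`). The orientations in `baseEvent` by themselves force these labels.

In the plane this extension property is impossible. It forces the cones under which `x` and `y` see
the segment `pq` to have no common direction (`coneSet_false`). But each such cone is open, so it
contains a member of a countable dense set. Some direction is therefore shared by a set of points
`x` of positive measure, and two independent samples both fall in that set with positive probability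
(`chir_law_ne_model`). -/

namespace PlanarOrder

/-! ### Chirotopes and product measures -/

/-- Families of signs indexed by triples; the orientations of a family of points form one. -/
abbrev Chirotope (ι : Type*) := ι → ι → ι → SignType

/-- The chirotope of a family `w`, where `D` plays the role of the signed area. -/
noncomputable def chir {α ι : Type*} (D : α → α → α → ℝ) (w : ι → α) : Chirotope ι :=
  fun i j k => SignType.sign (D (w i) (w j) (w k))

/-- The chirotope induced on a subfamily. -/
def Chirotope.pull {ι κ : Type*} (f : κ → ι) (c : Chirotope ι) : Chirotope κ :=
  fun i j k => c (f i) (f j) (f k)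

theorem chir_comp {α ι κ : Type*} (D : α → α → α → ℝ) (w : ι → α) (f : κ → ι) :
    chir D (w ∘ f) = (chir D w).pull f := rfl

section General

variable {α ι κ : Type*} [MeasurableSpace α]

theorem measurableSet_sign_eq {f : α → ℝ} (hf : Measurable f) (s : SignType) :
    MeasurableSet {a | SignType.sign (f a) = s} := by
  cases s with
  | zero =>
    have : {a | SignType.sign (f a) = SignType.zero} = {a | f a = 0} := by
      ext a; exact sign_eq_zero_iff
    rw [this]; exact measurableSet_eq_fun hf measurable_const
  | neg =>
    have : {a | SignType.sign (f a) = SignType.neg} = {a | f a < 0} := by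
      ext a; exact sign_eq_neg_one_iff
    rw [this]; exact measurableSet_lt hf measurable_const
  | pos =>
    have : {a | SignType.sign (f a) = SignType.pos} = {a | 0 < f a} := by
      ext a; exact sign_eq_one_iff
    rw [this]; exact measurableSet_lt measurable_const hf

theorem measurableSet_chir_mem [Finite ι] {D : α → α → α → ℝ}
    (hD : Measurable fun a : α × α × α => D a.1 a.2.1 a.2.2) (E : Set (Chirotope ι)) :
    MeasurableSet {w : ι → α | chir D w ∈ E} := by
  have h : {w : ι → α | chir D w ∈ E} = ⋃ c ∈ E, ⋂ i, ⋂ j, ⋂ k,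
      {w : ι → α | SignType.sign (D (w i) (w j) (w k)) = c i j k} := by
    ext w
    simp only [Set.mem_ofPred_eq, Set.mem_iUnion, Set.mem_iInter]
    constructor
    · intro h
      exact ⟨_, h, fun i j k => rfl⟩
    · rintro ⟨c, hc, h⟩
      have : chir D w = c := by funext i j k; exact h i j k
      rwa [this]
  rw [h]
  refine MeasurableSet.biUnion (Set.to_countable E) fun c _ => ?_
  refine MeasurableSet.iInter fun i => MeasurableSet.iInter fun j => MeasurableSet.iInter fun k => ?_
  have hijk : Measurable fun w : ι → α => (w i, w j, w k) := by fun_prop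
  exact measurableSet_sign_eq (hD.comp hijk) _

variable [Fintype ι] [Fintype κ]

theorem measurePreserving_sumElim (ν : Measure α) [SigmaFinite ν] :
    MeasurePreserving (fun p : (ι → α) × (κ → α) => (Sum.elim p.1 p.2 : ι ⊕ κ → α))
      ((Measure.pi fun _ => ν).prod (Measure.pi fun _ => ν)) (Measure.pi fun _ => ν) := by
  have := (measurePreserving_sumPiEquivProdPi_symm (fun _ : ι ⊕ κ => ν))
  convert this using 1
  funext p i
  cases i <;> rfl

theorem measurePreserving_comp_equiv (ν : Measure α) [SigmaFinite ν] (e : κ ≃ ι) :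
    MeasurePreserving (fun w : ι → α => w ∘ e) (Measure.pi fun _ => ν)
      (Measure.pi fun _ => ν) := by
  have := (measurePreserving_piCongrLeft (fun _ : κ => ν) e.symm)
  convert this using 1
  funext w i
  obtain ⟨j, rfl⟩ := e.symm.surjective i
  simp [MeasurableEquiv.coe_piCongrLeft, Equiv.piCongrLeft_apply_apply]

/-- Fubini, integrating first over coordinate `i`. This is how degenerate positions are shown
negligible. -/
theorem pi_eq_zero_of_update [DecidableEq ι] (ν : Measure α) [SigmaFinite ν] (i : ι)
    {S : Set (ι → α)} (hS : MeasurableSet S)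
    (h : ∀ w : ι → α, ν {a | Function.update w i a ∈ S} = 0) :
    Measure.pi (fun _ => ν) S = 0 := by
  rcases isEmpty_or_nonempty (ι → α) with he | ⟨⟨x⟩⟩
  · rw [Set.eq_empty_of_isEmpty S, measure_empty]
  rw [← lintegral_indicator_one hS, lintegral_eq_lmarginal_univ x,
    lmarginal_erase' _ (measurable_one.indicator hS) (Finset.mem_univ i)]
  have : (fun x : ι → α => ∫⁻ xi, (S.indicator 1 (Function.update x i xi) : ENNReal) ∂ν) =
      fun _ => 0 := by
    funext w
    have h2 : (fun a => (S.indicator 1 (Function.update w i a) : ENNReal)) =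
        {a | Function.update w i a ∈ S}.indicator 1 := by
      funext a; rfl
    rw [h2, lintegral_indicator_one, h]
    exact (measurable_update w) hS
  rw [this]
  simp [lmarginal]

end General

/-! ### Extensions of a sample by further points -/

section Extension

variable {α ι : Type*} [MeasurableSpace α] [Fintype ι] {G : α → α → α → ℝ}

theorem measurableSet_extension (hG : Measurable fun a : α × α × α => G a.1 a.2.1 a.2.2)
    (C : Set (Chirotope (ι ⊕ Fin 1))) (x : ι → α) :
    MeasurableSet {a | chir G (Sum.elim x fun _ : Fin 1 => a) ∈ C} := by
  refine measurableSet_preimage (f := fun a : α =>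
    (Sum.elim x fun _ : Fin 1 => a : ι ⊕ Fin 1 → α)) ?_ (measurableSet_chir_mem hG C)
  rw [measurable_pi_iff]
  rintro (i | i)
  · exact measurable_const
  · exact measurable_id

theorem measurable_measure_extension (hG : Measurable fun a : α × α × α => G a.1 a.2.1 a.2.2)
    (ρ : Measure α) [IsProbabilityMeasure ρ] (C : Set (Chirotope (ι ⊕ Fin 1))) :
    Measurable fun x : ι → α => ρ {a | chir G (Sum.elim x fun _ : Fin 1 => a) ∈ C} := by
  have hm := measurableSet_chir_mem hG C
  refine measurable_measure_prodMk_left (ν := ρ) (s := {p : (ι → α) × α |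
    chir G (Sum.elim p.1 fun _ : Fin 1 => p.2) ∈ C}) ?_
  refine measurableSet_preimage (f := fun p : (ι → α) × α =>
    (Sum.elim p.1 fun _ : Fin 1 => p.2 : ι ⊕ Fin 1 → α)) ?_ hm
  rw [measurable_pi_iff]
  rintro (i | i)
  · exact (measurable_pi_apply i).comp measurable_fst
  · exact measurable_snd

/-- Given `x`, the `N` further points are independent, so the chance that all of them fail is an
`N`-th power. The left side depends only on the law of finite chirotopes, so it can be compared
across measures. -/
theorem pi_no_extension_eq_lintegral
    (hG : Measurable fun a : α × α × α => G a.1 a.2.1 a.2.2) (ρ : Measure α)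
    [IsProbabilityMeasure ρ] (d : Set (Chirotope ι)) (C : Set (Chirotope (ι ⊕ Fin 1))) (N : ℕ) :
    Measure.pi (fun _ => ρ) {x : ι ⊕ Fin N → α | chir G x ∈ {c | c.pull Sum.inl ∈ d ∧
      ∀ i : Fin N, c.pull (Sum.map id fun _ : Fin 1 => i) ∉ C}} =
    ∫⁻ x in {x : ι → α | chir G x ∈ d},
      (ρ {a | chir G (Sum.elim x fun _ => a) ∈ C}ᶜ) ^ N ∂(Measure.pi fun _ => ρ) := by
  have hm := measurableSet_chir_mem hG {c : Chirotope (ι ⊕ Fin N) | c.pull Sum.inl ∈ d ∧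
      ∀ i : Fin N, c.pull (Sum.map id fun _ : Fin 1 => i) ∉ C}
  rw [← (measurePreserving_sumElim ρ).measure_preimage hm.nullMeasurableSet,
    Measure.prod_apply ((measurePreserving_sumElim ρ).measurable hm),
    ← lintegral_indicator (measurableSet_chir_mem hG d)]
  refine lintegral_congr fun x => ?_
  by_cases hx : chir G x ∈ d
  · rw [Set.indicator_of_mem (by exact hx)]
    have : (Prod.mk x ⁻¹' ((fun p : (ι → α) × (Fin N → α) =>
        (Sum.elim p.1 p.2 : ι ⊕ Fin N → α)) ⁻¹' {x : ι ⊕ Fin N → α | chir G x ∈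
        {c | c.pull Sum.inl ∈ d ∧
          ∀ i : Fin N, c.pull (Sum.map id fun _ : Fin 1 => i) ∉ C}})) =
        Set.pi Set.univ fun _ : Fin N => {a | chir G (Sum.elim x fun _ => a) ∈ C}ᶜ := by
      ext v
      simp only [Set.mem_preimage, Set.mem_ofPred_eq, ← chir_comp, Set.mem_pi, Set.mem_univ,
        Set.mem_compl_iff, forall_true_left, Sum.elim_comp_inl, hx, true_and,
        Sum.elim_comp_map, Function.comp_id]
      rfl
    rw [this, Measure.pi_pi]
    simp
  · rw [Set.indicator_of_notMem (by exact hx)]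
    convert measure_empty (μ := Measure.pi fun _ : Fin N => ρ)
    ext v
    simp only [Set.mem_preimage, Set.mem_ofPred_eq, ← chir_comp, Sum.elim_comp_inl, hx,
      false_and, Set.mem_empty_iff_false]

end Extension

/-- If the chirotopes of samples from `(ν, D)` and `(μ, F)` have the same laws, then the statement
that almost every sample satisfying `d` has with positive probability an extension satisfying `C`
carries over from `ν` to `μ`. -/
theorem pos_extension_of_law_eq {α β ι : Type*} [MeasurableSpace α] [MeasurableSpace β] [Fintype ι]
    {D : α → α → α → ℝ} {F : β → β → β → ℝ}
    (hD : Measurable fun a : α × α × α => D a.1 a.2.1 a.2.2)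
    (hF : Measurable fun a : β × β × β => F a.1 a.2.1 a.2.2)
    (ν : Measure α) (μ : Measure β) [IsProbabilityMeasure ν] [IsProbabilityMeasure μ]
    (hlaw : ∀ (N : ℕ) (E : Set (Chirotope (ι ⊕ Fin N))),
      Measure.pi (fun _ => μ) {x | chir F x ∈ E} = Measure.pi (fun _ => ν) {w | chir D w ∈ E})
    (d : Set (Chirotope ι)) (C : Set (Chirotope (ι ⊕ Fin 1)))
    (h : ∀ᵐ w ∂(Measure.pi fun _ : ι => ν), chir D w ∈ d →
      ν {a | chir D (Sum.elim w fun _ => a) ∈ C} ≠ 0) :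
    ∀ᵐ x ∂(Measure.pi fun _ : ι => μ), chir F x ∈ d →
      μ {b | chir F (Sum.elim x fun _ => b) ∈ C} ≠ 0 := by
  -- By `h`, a single failure has probability less than `1` for almost every `w` satisfying `d`, so
  -- its powers tend to `0`.
  have hlim : Tendsto (fun N : ℕ => ∫⁻ x in {x : ι → α | chir D x ∈ d},
        (ν {a | chir D (Sum.elim x fun _ => a) ∈ C}ᶜ) ^ N ∂(Measure.pi fun _ => ν))
        atTop (𝓝 (∫⁻ _ in {x : ι → α | chir D x ∈ d}, 0 ∂(Measure.pi fun _ => ν))) := by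
    refine tendsto_lintegral_of_dominated_convergence (fun _ => 1) ?_ ?_ ?_ ?_
    · intro N
      simp_rw [fun x => prob_compl_eq_one_sub (μ := ν) (measurableSet_extension hD C x)]
      exact ((measurable_const.sub (measurable_measure_extension hD ν C))).pow_const N
    · intro N
      exact ae_of_all _ fun x => pow_le_one₀ (by simp) prob_le_one
    · simp
    · rw [ae_restrict_iff' (measurableSet_chir_mem hD d)]
      filter_upwards [h] with w hw hwd
      refine ENNReal.tendsto_pow_atTop_nhds_zero_of_lt_one ?_
      exact lt_of_le_of_ne prob_le_one fun h1 =>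
        hw hwd ((prob_compl_eq_one_iff (measurableSet_extension hD C w)).1 h1)
  rw [lintegral_zero] at hlim
  -- The integrals for `μ` and `ν` agree by `hlaw`, and the integrand for `μ` equals `1` wherever
  -- extensions have probability `0`.
  have hle : ∀ N : ℕ, Measure.pi (fun _ => μ) {x : ι → β | chir F x ∈ d ∧
      μ {b | chir F (Sum.elim x fun _ => b) ∈ C} = 0} ≤
      ∫⁻ x in {x : ι → α | chir D x ∈ d},
        (ν {a | chir D (Sum.elim x fun _ => a) ∈ C}ᶜ) ^ N ∂(Measure.pi fun _ => ν) := by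
    intro N
    rw [← pi_no_extension_eq_lintegral hD ν d C N, ← hlaw, pi_no_extension_eq_lintegral hF μ d C N]
    have hms : MeasurableSet {x : ι → β | chir F x ∈ d ∧
      μ {b | chir F (Sum.elim x fun _ => b) ∈ C} = 0} :=
      (measurableSet_chir_mem hF d).inter (measurableSet_eq_fun (measurable_measure_extension hF μ C) measurable_const)
    rw [← lintegral_indicator_one hms, ← lintegral_indicator (measurableSet_chir_mem hF d)]
    refine lintegral_mono fun x => ?_
    by_cases hx : x ∈ {x : ι → β | chir F x ∈ d ∧
      μ {b | chir F (Sum.elim x fun _ => b) ∈ C} = 0}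
    · rw [Set.indicator_of_mem hx, Set.indicator_of_mem (by exact hx.1),
        (prob_compl_eq_one_iff (measurableSet_extension hF C x)).2 hx.2, one_pow]
      rfl
    · rw [Set.indicator_of_notMem hx]
      exact zero_le
  have h0 := ge_of_tendsto' hlim hle
  rw [ae_iff]
  convert le_antisymm h0 zero_le using 3
  simp

/-! ### Order types in terms of chirotopes -/

/-- Twice the signed area of the triangle `pqr`. -/
def area (p q r : Plane) : ℝ :=
  (q 0 - p 0) * (r 1 - p 1) - (q 1 - p 1) * (r 0 - p 0)

theorem measurable_area : Measurable fun a : Plane × Plane × Plane => area a.1 a.2.1 a.2.2 := by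
  unfold area
  fun_prop

/-- No three distinct indices have a vanishing sign. -/
def Chirotope.Generic {ι : Type*} (c : Chirotope ι) : Prop :=
  ∀ i j k, i ≠ j → i ≠ k → j ≠ k → c i j k ≠ 0

theorem chir_area_eq_zero {ι : Type*} (x : ι → Plane) {i j k : ι}
    (h : ¬ (i ≠ j ∧ i ≠ k ∧ j ≠ k)) : chir area x i j k = 0 := by
  have : area (x i) (x j) (x k) = 0 := by
    by_cases h1 : i = j
    · subst h1; simp [area]
    by_cases h2 : i = k
    · subst h2; simp [area]
    by_cases h3 : j = k
    · subst h3; simp only [area]; ring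
    exact absurd ⟨h1, h2, h3⟩ h
  simp [chir, this]

section

variable {ι : Type*} [Fintype ι]

/-- With a third index available, a repeated point would produce a degenerate triple; with fewer
than three indices genericity is vacuous. -/
theorem injective_of_generic (hι : 3 ≤ Fintype.card ι) {x : ι → Plane}
    (hx : (chir area x).Generic) : Function.Injective x := by
  classical
  intro i j hij
  by_contra hne
  obtain ⟨k, hk⟩ : ∃ k, k ∉ ({i, j} : Finset ι) := by
    by_contra! h
    have h1 : Fintype.card ι ≤ ({i, j} : Finset ι).card :=
      Finset.card_le_card fun k _ => h k
    have h2 : ({i, j} : Finset ι).card ≤ 2 := Finset.card_le_two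
    omega
  simp only [Finset.mem_insert, Finset.mem_singleton, not_or] at hk
  refine hx i j k hne (Ne.symm hk.1) (Ne.symm hk.2) ?_
  simp [chir, area, hij]

theorem isPointSet_range_of_generic {x : ι → Plane} (hx : (chir area x).Generic) :
    IsPointSet (Set.range x) where
  finite := Set.finite_range x
  not_aligned := by
    rintro _ ⟨i, rfl⟩ _ ⟨j, rfl⟩ _ ⟨k, rfl⟩ hij hik hjk
    exact hx i j k (fun h => hij (congrArg x h)) (fun h => hik (congrArg x h))
      (fun h => hjk (congrArg x h))

/-- The order type of a family of points in general position. -/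
def orderType {x : ι → Plane} (hx : (chir area x).Generic) : OType :=
  Quotient.mk pointSetSetoid ⟨Set.range x, isPointSet_range_of_generic hx⟩

theorem size_orderType (hι : 3 ≤ Fintype.card ι) {x : ι → Plane} (hx : (chir area x).Generic) :
    (orderType hx).size = Fintype.card ι := by
  change Nat.card (Set.range x) = _
  rw [← Nat.card_eq_fintype_card]
  exact Nat.card_congr (Equiv.ofInjective x (injective_of_generic hι hx)).symm

theorem realizes_orderType_iff (hι : 3 ≤ Fintype.card ι) {y : ι → Plane}
    (hy : (chir area y).Generic) (x : ι → Plane) :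
    Realizes (Set.range x) (orderType hy) ↔
      ∃ σ : Equiv.Perm ι, (chir area x).pull σ = chir area y := by
  have hyinj := injective_of_generic hι hy
  constructor
  · rintro ⟨hP, hq⟩
    obtain ⟨f, hf⟩ : SameOrderType (Set.range x) (Set.range y) := Quotient.exact hq
    -- `f` gives the range of `x` as many elements as `ι`, so counting excludes repetitions.
    have hxinj : Function.Injective x := by
      have e : ι ≃ Set.range x := (Equiv.ofInjective y hyinj).trans f.symm
      have h1 : Function.Bijective (Set.rangeFactorization x) :=
        (Fintype.bijective_iff_surjective_and_card _).2
          ⟨Set.rangeFactorization_surjective, Fintype.card_congr e⟩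
      exact Set.rangeFactorization_injective.1 h1.1
    refine ⟨((Equiv.ofInjective y hyinj).trans f.symm).trans
      (Equiv.ofInjective x hxinj).symm, ?_⟩
    set σ := ((Equiv.ofInjective y hyinj).trans f.symm).trans (Equiv.ofInjective x hxinj).symm
      with hσ
    have hfσ : ∀ i, f ⟨x (σ i), σ i, rfl⟩ = ⟨y i, i, rfl⟩ := by
      intro i
      have : (⟨x (σ i), σ i, rfl⟩ : Set.range x) = Equiv.ofInjective x hxinj (σ i) := rfl
      rw [this, hσ]
      simp [Equiv.ofInjective_apply]
    funext i j k
    by_cases h : i ≠ j ∧ i ≠ k ∧ j ≠ k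
    · have hne : ∀ {a b : ι}, a ≠ b →
          (⟨x (σ a), σ a, rfl⟩ : Set.range x) ≠ ⟨x (σ b), σ b, rfl⟩ := fun hab hc =>
        hab (σ.injective (hxinj (congrArg Subtype.val hc)))
      have := hf ⟨x (σ i), σ i, rfl⟩ ⟨x (σ j), σ j, rfl⟩ ⟨x (σ k), σ k, rfl⟩
        (hne h.1) (hne h.2.1) (hne h.2.2)
      rw [hfσ, hfσ, hfσ] at this
      exact this.symm
    · rw [chir_area_eq_zero y h, ← chir_comp, chir_area_eq_zero _ h]
  · rintro ⟨σ, hσ⟩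
    have hg : (chir area (x ∘ σ)).Generic := by rw [chir_comp, hσ]; exact hy
    have hrange : Set.range (x ∘ σ) = Set.range x := σ.surjective.range_comp x
    have hinj := injective_of_generic hι hg
    rw [← hrange]
    refine ⟨isPointSet_range_of_generic hg, Quotient.sound ?_⟩
    refine ⟨(Equiv.ofInjective _ hinj).symm.trans (Equiv.ofInjective y hyinj), ?_⟩
    rintro ⟨_, i, rfl⟩ ⟨_, j, rfl⟩ ⟨_, k, rfl⟩ _ _ _
    have hs : ∀ i, ((Equiv.ofInjective _ hinj).symm.trans (Equiv.ofInjective y hyinj))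
        ⟨(x ∘ σ) i, i, rfl⟩ = ⟨y i, i, rfl⟩ := by
      intro i
      have : (⟨(x ∘ σ) i, i, rfl⟩ : Set.range (x ∘ σ)) = Equiv.ofInjective _ hinj i := rfl
      rw [this, Equiv.trans_apply, Equiv.symm_apply_apply]
      rfl
    rw [hs, hs, hs]
    exact (congrFun (congrFun (congrFun hσ i) j) k).symm

theorem ell_eq_pi (μ : Measure Plane) [IsProbabilityMeasure μ] (ω : OType)
    (h : ω.size = Fintype.card ι) :
    ell μ ω = (Measure.pi fun _ : ι => μ).real {x | Realizes (Set.range x) ω} := by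
  let e : Fin ω.size ≃ ι := (finCongr h).trans (Fintype.equivFin ι).symm
  have hmp := (measurePreserving_piCongrLeft (fun _ : ι => μ) e)
  rw [ell, measureReal_def, measureReal_def, ← hmp.measure_preimage_equiv]
  congr 2
  ext x
  have : (MeasurableEquiv.piCongrLeft (fun _ : ι => Plane) e) x = x ∘ e.symm := by
    funext i
    obtain ⟨j, rfl⟩ := e.surjective i
    simp [MeasurableEquiv.coe_piCongrLeft, Equiv.piCongrLeft_apply_apply]
  simp only [Set.mem_preimage, Set.mem_ofPred_eq, this]
  rw [e.symm.surjective.range_comp]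

variable [DecidableEq ι]

/-- The relabelings of a chirotope. -/
def Chirotope.orbit (c : Chirotope ι) : Finset (Chirotope ι) :=
  Finset.univ.image fun σ : Equiv.Perm ι => c.pull σ

theorem card_orbit_pos (c : Chirotope ι) : 0 < c.orbit.card :=
  Finset.card_pos.2 ⟨c, Finset.mem_image.2 ⟨1, Finset.mem_univ _, rfl⟩⟩

/-- Independent samples are exchangeable, so all relabelings of `c` are equally likely. Distinct
permutations may give the same chirotope, hence the size of the orbit instead of a factorial. -/
theorem measureReal_pi_orbit {α : Type*} [MeasurableSpace α] {D : α → α → α → ℝ}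
    (hD : Measurable fun a : α × α × α => D a.1 a.2.1 a.2.2) (ν : Measure α)
    [IsProbabilityMeasure ν] (c : Chirotope ι) :
    (Measure.pi fun _ : ι => ν).real {w | ∃ σ : Equiv.Perm ι, (chir D w).pull σ = c} =
      c.orbit.card * (Measure.pi fun _ : ι => ν).real {w | chir D w = c} := by
  have h1 : {w : ι → α | ∃ σ : Equiv.Perm ι, (chir D w).pull σ = c} =
      ⋃ c' ∈ c.orbit, {w | chir D w = c'} := by
    ext w
    simp only [Set.mem_ofPred_eq, Set.mem_iUnion, Chirotope.orbit, Finset.mem_image,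
      Finset.mem_univ, true_and]
    constructor
    · rintro ⟨σ, rfl⟩
      refine ⟨chir D w, ⟨σ⁻¹, ?_⟩, rfl⟩
      funext i j k
      simp [Chirotope.pull]
    · rintro ⟨_, ⟨σ, rfl⟩, h⟩
      refine ⟨σ⁻¹, ?_⟩
      rw [h]
      funext i j k
      simp [Chirotope.pull]
  rw [h1, measureReal_biUnion_finset]
  · rw [Finset.sum_congr rfl (g := fun _ =>
      (Measure.pi fun _ : ι => ν).real {w | chir D w = c}), Finset.sum_const, nsmul_eq_mul]
    intro c' hc'
    obtain ⟨σ, -, rfl⟩ := Finset.mem_image.1 hc'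
    have hm := measurableSet_chir_mem (ι := ι) hD {c}
    have := (measurePreserving_comp_equiv ν σ⁻¹).measureReal_preimage hm.nullMeasurableSet
    refine Eq.trans ?_ this
    congr 1
    ext w
    simp only [Set.mem_ofPred_eq, Set.mem_preimage, chir_comp, Set.mem_singleton_iff]
    constructor
    · rintro h
      rw [h]
      funext i j k
      simp [Chirotope.pull]
    · rintro rfl
      funext i j k
      simp [Chirotope.pull]
  · intro c' _ c'' _ hne
    refine Set.disjoint_left.2 fun w h h' => hne ?_
    exact Eq.trans (Eq.symm h) h'
  · intro c' _
    exact measurableSet_chir_mem hD {c'}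

theorem ell_orderType (hι : 3 ≤ Fintype.card ι) {y : ι → Plane} (hy : (chir area y).Generic)
    (μ : Measure Plane) [IsProbabilityMeasure μ] :
    ell μ (orderType hy) = (chir area y).orbit.card *
      (Measure.pi fun _ : ι => μ).real {x | chir area x = chir area y} := by
  rw [ell_eq_pi μ _ (size_orderType hι hy), ← measureReal_pi_orbit measurable_area]
  congr 1
  ext x
  exact realizes_orderType_iff hι hy x

end

/-! ### Countability of order types and compactness -/

theorem sameOrderType_of_chir_eq {P Q : Set Plane} {n m : ℕ} (e : P ≃ Fin n) (e' : Q ≃ Fin m)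
    (h : (⟨n, chir area fun i => (e.symm i : Plane)⟩ : Σ n, Chirotope (Fin n)) =
      ⟨m, chir area fun i => (e'.symm i : Plane)⟩) : SameOrderType P Q := by
  obtain rfl : n = m := congrArg Sigma.fst h
  have h' := eq_of_heq (Sigma.mk.inj h).2
  refine ⟨e.trans e'.symm, fun p q r _ _ _ => ?_⟩
  have := congrFun (congrFun (congrFun h' (e p)) (e q)) (e r)
  simp only [chir, Equiv.symm_apply_apply] at this
  exact this.symm

theorem countable_oType : Countable OType := by
  have hfin : ∀ ω : OType, Finite (Quotient.out (s := pointSetSetoid) ω).1 := fun ω =>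
    (Quotient.out (s := pointSetSetoid) ω).2.finite
  let F : OType → Σ n, Chirotope (Fin n) := fun ω =>
    ⟨_, chir area fun i => ((Finite.equivFin (Quotient.out (s := pointSetSetoid) ω).1).symm i : Plane)⟩
  refine Function.Injective.countable (f := F) fun ω ω' h => ?_
  rw [← Quotient.out_eq (s := pointSetSetoid) ω, ← Quotient.out_eq (s := pointSetSetoid) ω']
  exact Quotient.sound (sameOrderType_of_chir_eq _ _ h)

theorem ell_mem_Icc (μ : Measure Plane) [IsProbabilityMeasure μ] (ω : OType) :
    ell μ ω ∈ Set.Icc (0 : ℝ) 1 := ⟨measureReal_nonneg, measureReal_le_one⟩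

/-- Any sequence of functions `ℓ_μ` has a pointwise convergent subsequence. -/
theorem exists_subseq_tendsto_ell (μ : ℕ → Measure Plane) [∀ n, IsProbabilityMeasure (μ n)] :
    ∃ (l : OType → ℝ) (φ : ℕ → ℕ), StrictMono φ ∧
      ∀ ω, Tendsto (fun k => ell (μ (φ k)) ω) atTop (𝓝 (l ω)) := by
  have := countable_oType
  obtain ⟨l, -, φ, hφ, hl⟩ := (isCompact_univ_pi fun _ : OType =>
    isCompact_Icc (a := (0 : ℝ)) (b := 1)).tendsto_subseq (x := fun n => ell (μ n))
    fun n ω _ => ell_mem_Icc (μ n) ω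
  exact ⟨l, φ, hφ, fun ω => (tendsto_pi_nhds.1 hl ω)⟩

/-! ### Trigonometry on the circle of angles -/

/-- The circle of angles. -/
abbrev Ang : Type := AddCircle (2 * Real.pi)

instance : Fact (0 < 2 * Real.pi) := ⟨Real.two_pi_pos⟩

/-- The cosine of an angle. -/
noncomputable def ux (θ : Ang) : ℝ := Real.Angle.cos θ

/-- The sine of an angle. -/
noncomputable def uy (θ : Ang) : ℝ := Real.Angle.sin θ

theorem continuous_ux : Continuous ux := Real.Angle.continuous_cos

theorem continuous_uy : Continuous uy := Real.Angle.continuous_sin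

theorem ux_coe (θ : ℝ) : ux (θ : Ang) = Real.cos θ := Real.Angle.cos_coe θ

theorem uy_coe (θ : ℝ) : uy (θ : Ang) = Real.sin θ := Real.Angle.sin_coe θ

theorem ux_sq_add_uy_sq (θ : Ang) : ux θ ^ 2 + uy θ ^ 2 = 1 := Real.Angle.cos_sq_add_sin_sq θ

theorem ang_ext {θ φ : Ang} (hx : ux θ = ux φ) (hy : uy θ = uy φ) : θ = φ := by
  induction θ using QuotientAddGroup.induction_on with
  | H x =>
    induction φ using QuotientAddGroup.induction_on with
    | H y => exact Real.Angle.cos_sin_inj hx hy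

theorem exists_polar {u v : ℝ} (h : u ≠ 0 ∨ v ≠ 0) :
    ∃ (θ : Ang) (r : ℝ), 0 < r ∧ r * ux θ = u ∧ r * uy θ = v := by
  have hz : (⟨u, v⟩ : ℂ) ≠ 0 := by
    intro h0
    rcases h with h | h
    · exact h (congrArg Complex.re h0)
    · exact h (congrArg Complex.im h0)
  refine ⟨((Complex.arg ⟨u, v⟩ : ℝ) : Ang), ‖(⟨u, v⟩ : ℂ)‖, norm_pos_iff.2 hz, ?_, ?_⟩
  · rw [ux_coe]; exact Complex.norm_mul_cos_arg _
  · rw [uy_coe]; exact Complex.norm_mul_sin_arg _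

theorem exists_ang {u v : ℝ} (h : u ^ 2 + v ^ 2 = 1) : ∃ θ : Ang, ux θ = u ∧ uy θ = v := by
  obtain ⟨θ, r, hr, h1, h2⟩ := exists_polar (u := u) (v := v) (by
    by_contra! h0
    rw [h0.1, h0.2] at h
    norm_num at h)
  have hr1 : r = 1 := by
    have := ux_sq_add_uy_sq θ
    have h3 : r ^ 2 = 1 := by
      rw [← h1, ← h2] at h
      linear_combination h - r ^ 2 * this
    nlinarith
  subst hr1
  exact ⟨θ, by linarith, by linarith⟩

/-- The cross product of the unit vectors of angles `θ` and `φ`. -/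
noncomputable def cr (θ φ : Ang) : ℝ := ux θ * uy φ - uy θ * ux φ

theorem cr_eq_uy_sub (θ φ : Ang) : cr θ φ = uy (φ - θ) := by
  have h : uy (φ + -θ) = uy φ * ux (-θ) + ux φ * uy (-θ) := Real.Angle.sin_add φ (-θ)
  have h1 : ux (-θ) = ux θ := Real.Angle.cos_neg θ
  have h2 : uy (-θ) = -uy θ := Real.Angle.sin_neg θ
  rw [sub_eq_add_neg, h, h1, h2, cr]
  ring

theorem uy_eq_uy_iff {θ φ : Ang} : uy θ = uy φ ↔ θ = φ ∨ θ + φ = ((Real.pi : ℝ) : Ang) :=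
  Real.Angle.sin_eq_iff_eq_or_add_eq_pi

theorem cr_eq_zero {θ φ : Ang} (h : cr θ φ = 0) : φ = θ ∨ φ = θ + ((Real.pi : ℝ) : Ang) := by
  rw [cr_eq_uy_sub] at h
  have h0 : uy (φ - θ) = uy (0 : Ang) := by rw [h]; exact Real.Angle.sin_zero.symm
  rcases uy_eq_uy_iff.1 h0 with h1 | h1
  · left; exact sub_eq_zero.1 h1
  · right; rw [add_zero] at h1; rw [← h1]; abel

/-- The hypothesis says that the direction `θ` is parallel to the chord from `φ` to `ψ`;
equivalently, `φ - θ` and `ψ - θ` have the same sine. -/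
theorem cr_add_cr_eq_zero {θ φ ψ : Ang} (h : cr θ φ + cr ψ θ = 0) :
    φ = ψ ∨ φ = ((Real.pi : ℝ) : Ang) + θ + θ - ψ := by
  have h0 : uy (φ - θ) = uy (ψ - θ) := by
    rw [← cr_eq_uy_sub, ← cr_eq_uy_sub]
    simp only [cr] at h ⊢
    linarith
  rcases uy_eq_uy_iff.1 h0 with h1 | h1
  · left; exact sub_left_injective h1
  · right; rw [← h1]; abel

/-- A line meets a circle in at most two points. With `(e, e')` and `(f, f')` the chords issued from
the first point, parallel chords satisfy `|f|² = e · f` and then `|e|² = |f|²`, so they coincide. -/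
theorem cr_sum_eq_zero {θ φ ψ : Ang} (h : cr θ φ + cr φ ψ + cr ψ θ = 0) :
    θ = φ ∨ θ = ψ ∨ φ = ψ := by
  have h1 := ux_sq_add_uy_sq θ
  have h2 := ux_sq_add_uy_sq φ
  have h3 := ux_sq_add_uy_sq ψ
  have heq : ∀ {α β : Ang}, (ux α - ux β) ^ 2 + (uy α - uy β) ^ 2 = 0 → α = β := by
    intro α β hab
    have hx : ux α - ux β = 0 := by nlinarith [sq_nonneg (ux α - ux β), sq_nonneg (uy α - uy β)]
    have hy : uy α - uy β = 0 := by nlinarith [sq_nonneg (ux α - ux β), sq_nonneg (uy α - uy β)]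
    exact ang_ext (by linarith) (by linarith)
  by_contra! hne
  obtain ⟨hab, hac, hbc⟩ := hne
  simp only [cr] at h
  set a := ux θ
  set b := uy θ
  obtain ⟨e, he⟩ : ∃ e, e = ux φ - a := ⟨_, rfl⟩
  obtain ⟨e', he'⟩ : ∃ e, e = uy φ - b := ⟨_, rfl⟩
  obtain ⟨f, hf⟩ : ∃ e, e = ux ψ - a := ⟨_, rfl⟩
  obtain ⟨f', hf'⟩ : ∃ e, e = uy ψ - b := ⟨_, rfl⟩
  have hφ : ux φ = a + e := by linarith
  have hφ' : uy φ = b + e' := by linarith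
  have hψ : ux ψ = a + f := by linarith
  have hψ' : uy ψ = b + f' := by linarith
  rw [hφ, hφ', hψ, hψ'] at h
  rw [hφ, hφ'] at h2
  rw [hψ, hψ'] at h3
  have hx : e * f' - e' * f = 0 := by linear_combination h
  have hE : e ^ 2 + e' ^ 2 ≠ 0 := fun h0 => hab (heq (by rw [hφ, hφ']; linear_combination h0))
  have hF : f ^ 2 + f' ^ 2 ≠ 0 := fun h0 => hac (heq (by rw [hψ, hψ']; linear_combination h0))
  have h4 : (e ^ 2 + e' ^ 2) * ((f ^ 2 + f' ^ 2) - (e * f + e' * f')) = 0 := by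
    linear_combination (e ^ 2 + e' ^ 2) * (h3 - h1) - (e * f + e' * f') * (h2 - h1)
      + 2 * (a * e' - b * e) * hx
  have h5 : f ^ 2 + f' ^ 2 = e * f + e' * f' := by
    rcases mul_eq_zero.1 h4 with h | h
    · exact absurd h hE
    · linarith
  have h6 : (f ^ 2 + f' ^ 2) * ((e ^ 2 + e' ^ 2) - (f ^ 2 + f' ^ 2)) = 0 := by
    linear_combination (e * f' - e' * f) * hx - ((f ^ 2 + f' ^ 2) + (e * f + e' * f')) * h5
  have h7 : e ^ 2 + e' ^ 2 = f ^ 2 + f' ^ 2 := by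
    rcases mul_eq_zero.1 h6 with h | h
    · exact absurd h hF
    · linarith
  exact hbc (heq (by rw [hφ, hφ', hψ, hψ']; linear_combination h7 + 2 * h5))

/-! ### The limit model and its comparison with the two circles -/

/-- Labeled angles: `true` labels the points of the outer circle, `false` those of the inner one. -/
abbrev Model : Type := Bool × Ang

/-- The uniform distribution on labeled angles. -/
noncomputable def modelMeasure : Measure Model :=
  (2⁻¹ : ENNReal) • Measure.map (Prod.mk true) AddCircle.haarAddCircle +
    (2⁻¹ : ENNReal) • Measure.map (Prod.mk false) AddCircle.haarAddCircle

theorem modelMeasure_apply {S : Set Model} (hS : MeasurableSet S) :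
    modelMeasure S = 2⁻¹ * AddCircle.haarAddCircle (Prod.mk true ⁻¹' S) +
      2⁻¹ * AddCircle.haarAddCircle (Prod.mk false ⁻¹' S) := by
  rw [modelMeasure, Measure.add_apply, Measure.smul_apply, Measure.smul_apply,
    Measure.map_apply measurable_prodMk_left hS, Measure.map_apply measurable_prodMk_left hS,
    smul_eq_mul, smul_eq_mul]

instance : IsProbabilityMeasure modelMeasure := ⟨by
  rw [modelMeasure_apply MeasurableSet.univ]
  simp [ENNReal.inv_two_add_inv_two]⟩

instance : modelMeasure.IsOpenPosMeasure := ⟨by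
  rintro U hU ⟨⟨b, θ⟩, hb⟩ h0
  rw [modelMeasure_apply hU.measurableSet, add_eq_zero, mul_eq_zero, mul_eq_zero] at h0
  have hpos : ∀ b : Bool, (b, θ) ∈ U → AddCircle.haarAddCircle (Prod.mk b ⁻¹' U) ≠ 0 :=
    fun b hb => (hU.preimage (by fun_prop)).measure_ne_zero _ ⟨θ, hb⟩
  cases b
  · exact hpos false hb (h0.2.resolve_left (by simp))
  · exact hpos true hb (h0.1.resolve_left (by simp))⟩

theorem haarAddCircle_singleton (θ : Ang) : AddCircle.haarAddCircle {θ} = 0 := by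
  have h := AddCircle.volume_closedBall (2 * Real.pi) (x := θ) 0
  rw [Metric.closedBall_zero, AddCircle.volume_eq_smul_haarAddCircle] at h
  have h2 : min (2 * Real.pi) (2 * 0) = 0 := by
    rw [mul_zero]; exact min_eq_right (by positivity)
  rw [h2, Measure.smul_apply, ENNReal.ofReal_zero, smul_eq_mul, mul_eq_zero] at h
  exact h.resolve_left (by simp [Real.pi_pos])

theorem modelMeasure_snd_eq (θ : Ang) : modelMeasure {a | a.2 = θ} = 0 := by
  have hm : MeasurableSet {a : Model | a.2 = θ} :=
    measurable_snd (measurableSet_singleton θ)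
  have h : ∀ b : Bool, Prod.mk b ⁻¹' {a : Model | a.2 = θ} = {θ} := fun b => by ext; simp
  rw [modelMeasure_apply hm, h, h, haarAddCircle_singleton]
  simp

/-- The radius of the circle with the given label. -/
def radius (t : ℝ) (b : Bool) : ℝ := if b then 1 else t

/-- The point on the circle of radius `1` or `t` with the given label and angle. -/
noncomputable def emb (t : ℝ) (a : Model) : Plane :=
  !₂[radius t a.1 * ux a.2, radius t a.1 * uy a.2]

theorem measurable_emb (t : ℝ) : Measurable (emb t) := by
  have h1 : Measurable fun a : Model => radius t a.1 :=
    (Measurable.of_discrete (f := radius t)).comp measurable_fst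
  have h2 : Measurable fun a : Model => ux a.2 := continuous_ux.measurable.comp measurable_snd
  have h3 : Measurable fun a : Model => uy a.2 := continuous_uy.measurable.comp measurable_snd
  unfold emb
  refine (MeasurableEquiv.toLp 2 (Fin 2 → ℝ)).measurable.comp ?_
  rw [measurable_pi_iff]
  intro i
  fin_cases i
  · exact h1.mul h2
  · exact h1.mul h3

theorem map_haarAddCircle (f : Ang → Plane) (hf : Measurable f) :
    Measure.map (fun θ : ℝ => f (θ : Ang))
      ((ENNReal.ofReal (2 * Real.pi))⁻¹ • volume.restrict (Set.Ioc 0 (2 * Real.pi))) =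
      Measure.map f AddCircle.haarAddCircle := by
  have h := AddCircle.measurePreserving_mk (2 * Real.pi) 0
  rw [zero_add] at h
  have h2 : (AddCircle.haarAddCircle : Measure Ang) =
      (ENNReal.ofReal (2 * Real.pi))⁻¹ • volume := by
    rw [AddCircle.volume_eq_smul_haarAddCircle, smul_smul, ENNReal.inv_mul_cancel, one_smul]
    · simp [Real.pi_pos]
    · exact ENNReal.ofReal_ne_top
  rw [h2, Measure.map_smul, Measure.map_smul, ← h.map_eq, Measure.map_map hf h.measurable]
  rfl

theorem odot_eq_map_emb (t : ℝ) : odot t = Measure.map (emb t) modelMeasure := by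
  have hc : ∀ b : Bool, circleUnif (radius t b) =
      Measure.map (emb t) (Measure.map (Prod.mk b) AddCircle.haarAddCircle) := by
    intro b
    rw [Measure.map_map (measurable_emb t) measurable_prodMk_left, ← map_haarAddCircle _
      ((measurable_emb t).comp measurable_prodMk_left)]
    rfl
  rw [modelMeasure, Measure.map_add _ _ (measurable_emb t), Measure.map_smul, Measure.map_smul,
    ← hc, ← hc]
  rfl

instance (t : ℝ) : IsProbabilityMeasure (odot t) := by
  rw [odot_eq_map_emb]
  exact Measure.isProbabilityMeasure_map (measurable_emb t).aemeasurable

/-- The coefficient, in the leading term of the signed area, of the cross product of two points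
labeled `a` and `b` when the third point is labeled `c`. -/
def leadingCoeff (a b c : Bool) : ℝ := if (a && b) || !c then 1 else 0

/-- The coefficient of the leading term, as `t` tends to `0`, of the signed area of a triangle whose
vertices lie on the circles of radii `1` and `t`. -/
noncomputable def limArea (a b c : Model) : ℝ :=
  leadingCoeff a.1 b.1 c.1 * cr a.2 b.2 + leadingCoeff b.1 c.1 a.1 * cr b.2 c.2 +
    leadingCoeff c.1 a.1 b.1 * cr c.2 a.2

theorem limArea_rotate (a b c : Model) : limArea b c a = limArea a b c := by
  simp only [limArea]; ring

theorem limArea_self_left (a c : Model) : limArea a a c = 0 := by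
  obtain ⟨a, θ⟩ := a
  obtain ⟨c, φ⟩ := c
  cases a <;> cases c <;> simp [limArea, leadingCoeff, cr] <;> ring

theorem continuous_limArea :
    Continuous fun a : Model × Model × Model => limArea a.1 a.2.1 a.2.2 := by
  have hk : Continuous fun a : Bool × Bool × Bool => leadingCoeff a.1 a.2.1 a.2.2 :=
    continuous_of_discreteTopology
  have hc : Continuous fun a : Ang × Ang => cr a.1 a.2 := by
    have := continuous_ux
    have := continuous_uy
    unfold cr
    fun_prop
  have hk' : ∀ {f g h : Model × Model × Model → Bool}, Continuous f → Continuous g →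
      Continuous h → Continuous fun a => leadingCoeff (f a) (g a) (h a) :=
    fun hf hg hh => hk.comp (hf.prodMk (hg.prodMk hh))
  have hc' : ∀ {f g : Model × Model × Model → Ang}, Continuous f → Continuous g →
      Continuous fun a => cr (f a) (g a) := fun hf hg => hc.comp (hf.prodMk hg)
  unfold limArea
  exact (((hk' (by fun_prop) (by fun_prop) (by fun_prop)).mul
    (hc' (by fun_prop) (by fun_prop))).add
    ((hk' (by fun_prop) (by fun_prop) (by fun_prop)).mul
    (hc' (by fun_prop) (by fun_prop)))).add
    ((hk' (by fun_prop) (by fun_prop) (by fun_prop)).mul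
    (hc' (by fun_prop) (by fun_prop)))

instance : SecondCountableTopology Ang :=
  inferInstanceAs (SecondCountableTopology (ℝ ⧸ AddSubgroup.zmultiples (2 * Real.pi)))

theorem measurable_limArea :
    Measurable fun a : Model × Model × Model => limArea a.1 a.2.1 a.2.2 :=
  continuous_limArea.measurable

theorem area_emb (t : ℝ) (a b c : Model) : area (emb t a) (emb t b) (emb t c) =
    radius t a.1 * radius t b.1 * cr a.2 b.2 + radius t b.1 * radius t c.1 * cr b.2 c.2 +
      radius t c.1 * radius t a.1 * cr c.2 a.2 := by
  simp only [area, emb, cr, PiLp.toLp_apply, Matrix.cons_val_zero, Matrix.cons_val_one]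
  ring

/-- Each cross product in the area is weighted by the product of two radii, and the heaviest terms
are those omitting a vertex of smallest radius. This is what `leadingCoeff` selects; `t ^ m` is
their common weight. -/
theorem exists_area_emb_eq (a b c : Model) : ∃ (m : ℕ) (R : ℝ), ∀ t : ℝ,
    area (emb t a) (emb t b) (emb t c) = t ^ m * (limArea a b c + t * R) := by
  obtain ⟨a, θ⟩ := a
  obtain ⟨b, φ⟩ := b
  obtain ⟨c, ψ⟩ := c
  simp only [area_emb, limArea]
  cases a <;> cases b <;> cases c <;> simp only [radius, leadingCoeff] <;>
    simp only [Bool.false_eq_true, if_false, if_true, Bool.and_true, Bool.and_false,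
      Bool.not_true, Bool.not_false, Bool.or_true, Bool.or_false, Bool.and_self, Bool.or_self]
  · exact ⟨2, 0, fun t => by ring⟩
  · exact ⟨1, cr θ φ, fun t => by ring⟩
  · exact ⟨1, cr ψ θ, fun t => by ring⟩
  · exact ⟨0, cr θ φ + cr ψ θ, fun t => by ring⟩
  · exact ⟨1, cr φ ψ, fun t => by ring⟩
  · exact ⟨0, cr θ φ + cr φ ψ, fun t => by ring⟩
  · exact ⟨0, cr φ ψ + cr ψ θ, fun t => by ring⟩
  · exact ⟨0, 0, fun t => by ring⟩

theorem eventually_sign_area_emb {a b c : Model} (h : limArea a b c ≠ 0) :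
    ∀ᶠ t in 𝓝[>] (0 : ℝ), SignType.sign (area (emb t a) (emb t b) (emb t c)) =
      SignType.sign (limArea a b c) := by
  obtain ⟨m, R, hR⟩ := exists_area_emb_eq a b c
  have ht : Tendsto (fun t : ℝ => limArea a b c + t * R) (𝓝[>] 0) (𝓝 (limArea a b c)) := by
    have : Continuous fun t : ℝ => limArea a b c + t * R := by fun_prop
    simpa using (this.tendsto 0).mono_left nhdsWithin_le_nhds
  have hpos : ∀ᶠ t in 𝓝[>] (0 : ℝ), 0 < t := self_mem_nhdsWithin
  rcases lt_or_gt_of_ne h with hlt | hgt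
  · filter_upwards [ht.eventually (gt_mem_nhds hlt), hpos] with t h1 h2
    rw [hR, sign_neg (mul_neg_of_pos_of_neg (pow_pos h2 m) h1), sign_neg hlt]
  · filter_upwards [ht.eventually (lt_mem_nhds hgt), hpos] with t h1 h2
    rw [hR, sign_pos (mul_pos (pow_pos h2 m) h1), sign_pos hgt]

section

variable {ι : Type*}

theorem chir_limArea_eq_zero (w : ι → Model) {i j k : ι}
    (h : ¬ (i ≠ j ∧ i ≠ k ∧ j ≠ k)) : chir limArea w i j k = 0 := by
  have : limArea (w i) (w j) (w k) = 0 := by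
    by_cases h1 : i = j
    · subst h1; exact limArea_self_left _ _
    by_cases h2 : i = k
    · subst h2; rw [← limArea_rotate, ← limArea_rotate]; exact limArea_self_left _ _
    by_cases h3 : j = k
    · subst h3; rw [← limArea_rotate]; exact limArea_self_left _ _
    exact absurd ⟨h1, h2, h3⟩ h
  simp [chir, this]

theorem eventually_chir_emb [Finite ι] {w : ι → Model} (hw : (chir limArea w).Generic) :
    ∀ᶠ t in 𝓝[>] (0 : ℝ), chir area (emb t ∘ w) = chir limArea w := by
  have : ∀ i j k, ∀ᶠ t in 𝓝[>] (0 : ℝ),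
      chir area (emb t ∘ w) i j k = chir limArea w i j k := by
    intro i j k
    by_cases h : i ≠ j ∧ i ≠ k ∧ j ≠ k
    · exact eventually_sign_area_emb (sign_ne_zero.1 (hw i j k h.1 h.2.1 h.2.2))
    · refine Eventually.of_forall fun t => ?_
      rw [chir_limArea_eq_zero w h, chir_area_eq_zero _ h]
  have h2 := eventually_all.2 fun i => eventually_all.2 fun j => eventually_all.2 fun k => this i j k
  filter_upwards [h2] with t ht
  funext i j k
  exact ht i j k

theorem ae_snd_ne [Fintype ι] (k : ι) (F : (ι → Model) → Ang) (hF : Measurable F)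
    (hk : ∀ w w' : ι → Model, (∀ i, i ≠ k → w i = w' i) → F w = F w') :
    ∀ᵐ w ∂(Measure.pi fun _ : ι => modelMeasure), (w k).2 ≠ F w := by
  classical
  rw [ae_iff]
  simp only [ne_eq, not_not]
  refine pi_eq_zero_of_update modelMeasure k ?_ fun w => ?_
  · exact measurableSet_eq_fun (measurable_snd.comp (measurable_pi_apply k)) hF
  · have : {a | Function.update w k a ∈ {w : ι → Model | (w k).2 = F w}} = {a | a.2 = F w} := by
      ext a
      simp only [Set.mem_ofPred_eq, Function.update_self]
      rw [hk (Function.update w k a) w fun i hi => Function.update_of_ne hi _ _]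
    rw [this, modelMeasure_snd_eq]

/-- The three groups of hypotheses exclude coincident angles, antipodal angles, and an angle
parallel to the chord of the other two. These are the ways in which the leading terms can vanish,
according to the labels. -/
theorem limArea_ne_zero {a b c : Model} (hab : a.2 ≠ b.2) (hac : a.2 ≠ c.2) (hbc : b.2 ≠ c.2)
    (hab' : b.2 ≠ a.2 + ((Real.pi : ℝ) : Ang)) (hbc' : c.2 ≠ b.2 + ((Real.pi : ℝ) : Ang))
    (hca' : a.2 ≠ c.2 + ((Real.pi : ℝ) : Ang))
    (ha : b.2 ≠ ((Real.pi : ℝ) : Ang) + a.2 + a.2 - c.2)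
    (hb : c.2 ≠ ((Real.pi : ℝ) : Ang) + b.2 + b.2 - a.2)
    (hc : a.2 ≠ ((Real.pi : ℝ) : Ang) + c.2 + c.2 - b.2) : limArea a b c ≠ 0 := by
  obtain ⟨a, θ⟩ := a
  obtain ⟨b, φ⟩ := b
  obtain ⟨c, ψ⟩ := c
  simp only at hab hac hbc hab' hbc' hca' ha hb hc
  intro h
  have h3 : cr θ φ + cr φ ψ + cr ψ θ ≠ 0 := fun h => by
    rcases cr_sum_eq_zero h with h | h | h
    exacts [hab h, hac h, hbc h]
  have h1 : ∀ {α β : Ang}, α ≠ β → β ≠ α + ((Real.pi : ℝ) : Ang) → cr α β ≠ 0 := fun h1 h2 h => by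
    rcases cr_eq_zero h with h | h
    exacts [h1 h.symm, h2 h]
  have h2 : ∀ {α β γ : Ang}, β ≠ γ → β ≠ ((Real.pi : ℝ) : Ang) + α + α - γ →
      cr α β + cr γ α ≠ 0 := fun h1 h2 h => by
    rcases cr_add_cr_eq_zero h with h | h
    exacts [h1 h, h2 h]
  simp only [limArea] at h
  cases a <;> cases b <;> cases c <;> simp only [leadingCoeff] at h <;>
    simp only [Bool.false_eq_true, if_false, if_true, Bool.and_true, Bool.and_false,
      Bool.not_true, Bool.not_false, Bool.or_true, Bool.or_false, Bool.and_self, Bool.or_self,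
      one_mul, zero_mul, add_zero, zero_add] at h
  · exact h3 h
  · exact h2 hab hc (by linarith)
  · exact h2 (Ne.symm hac) hb (by linarith)
  · exact h1 hbc hbc' h
  · exact h2 hbc ha h
  · exact h1 (Ne.symm hac) hca' h
  · exact h1 hab hab' h
  · exact h3 h

/-- Each degeneracy fixes one angle as a function of the other samples, and the uniform distribution
has no atoms. -/
theorem ae_generic [Fintype ι] :
    ∀ᵐ w ∂(Measure.pi fun _ : ι => modelMeasure), (chir limArea w).Generic := by
  have hev : ∀ i : ι, Measurable fun w : ι → Model => (w i).2 := fun i =>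
    measurable_snd.comp (measurable_pi_apply i)
  have h1 : ∀ᵐ w ∂(Measure.pi fun _ : ι => modelMeasure), ∀ i j : ι, i ≠ j → (w i).2 ≠ (w j).2 := by
    refine ae_all_iff.2 fun i => ae_all_iff.2 fun j => ?_
    by_cases hij : i = j
    · simp [hij]
    filter_upwards [ae_snd_ne i (fun w => (w j).2) (hev j)
      fun w w' h => by rw [h j (Ne.symm hij)]] with w hw _ using hw
  have h2 : ∀ᵐ w ∂(Measure.pi fun _ : ι => modelMeasure), ∀ i j : ι, i ≠ j →
      (w i).2 ≠ (w j).2 + ((Real.pi : ℝ) : Ang) := by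
    refine ae_all_iff.2 fun i => ae_all_iff.2 fun j => ?_
    by_cases hij : i = j
    · simp [hij]
    filter_upwards [ae_snd_ne i (fun w => (w j).2 + ((Real.pi : ℝ) : Ang)) ((hev j).add_const _)
      fun w w' h => by rw [h j (Ne.symm hij)]] with w hw _ using hw
  have h3 : ∀ᵐ w ∂(Measure.pi fun _ : ι => modelMeasure), ∀ i j k : ι, i ≠ j → i ≠ k →
      (w i).2 ≠ ((Real.pi : ℝ) : Ang) + (w j).2 + (w j).2 - (w k).2 := by
    refine ae_all_iff.2 fun i => ae_all_iff.2 fun j => ae_all_iff.2 fun k => ?_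
    by_cases hij : i = j
    · simp [hij]
    by_cases hik : i = k
    · simp [hik]
    filter_upwards [ae_snd_ne i (fun w => ((Real.pi : ℝ) : Ang) + (w j).2 + (w j).2 - (w k).2)
      ((((hev j).const_add _).add (hev j)).sub (hev k))
      fun w w' h => by rw [h j (Ne.symm hij), h k (Ne.symm hik)]] with w hw _ _ using hw
  filter_upwards [h1, h2, h3] with w h1 h2 h3 i j k hij hik hjk
  refine sign_ne_zero.2 (limArea_ne_zero (h1 _ _ hij) (h1 _ _ hik) (h1 _ _ hjk)
    (h2 _ _ hij.symm) (h2 _ _ hjk.symm) (h2 _ _ hik) (h3 _ _ _ hij.symm hjk)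
    (h3 _ _ _ hjk.symm hik.symm) (h3 _ _ _ hik hij))

/-! ### Laws of chirotopes in the limit -/

variable [Fintype ι]

theorem pi_odot_chir (t : ℝ) (E : Set (Chirotope ι)) :
    Measure.pi (fun _ : ι => odot t) {x | chir area x ∈ E} =
      Measure.pi (fun _ : ι => modelMeasure) {w | chir area (emb t ∘ w) ∈ E} := by
  have hp : IsProbabilityMeasure (Measure.map (emb t) modelMeasure) := by
    rw [← odot_eq_map_emb]; infer_instance
  rw [odot_eq_map_emb, ← Measure.pi_map_pi fun _ => (measurable_emb t).aemeasurable,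
    Measure.map_apply (by
      rw [measurable_pi_iff]
      exact fun i => (measurable_emb t).comp (measurable_pi_apply i))
      (measurableSet_chir_mem measurable_area E)]
  rfl

theorem tendsto_pi_odot_chir (E : Set (Chirotope ι)) {u : ℕ → ℝ}
    (hu : Tendsto u atTop (𝓝[>] 0)) :
    Tendsto (fun n => Measure.pi (fun _ : ι => odot (u n)) {x | chir area x ∈ E}) atTop
      (𝓝 (Measure.pi (fun _ : ι => modelMeasure) {w | chir limArea w ∈ E})) := by
  simp only [pi_odot_chir]
  refine tendsto_measure_of_ae_tendsto_indicator_of_isFiniteMeasure atTop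
    (measurableSet_chir_mem measurable_limArea E) (fun n => ?_) ?_
  · have hm : Measurable fun w : ι → Model => emb (u n) ∘ w := by
      rw [measurable_pi_iff]
      exact fun i => (measurable_emb _).comp (measurable_pi_apply i)
    exact hm (measurableSet_chir_mem measurable_area E)
  · filter_upwards [ae_generic] with w hw
    filter_upwards [hu.eventually (eventually_chir_emb hw)] with n hn
    simp only [hn]

/-- If the functions `ℓ` of `⊙_t` converge to that of `μ` along some sequence of radii tending
to `0`, then the chirotopes of samples from `μ` and of samples from the limit model have the
same law. -/
theorem pi_chir_eq_model (hι : 3 ≤ Fintype.card ι) (μ : Measure Plane) [IsProbabilityMeasure μ]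
    {u : ℕ → ℝ} (hu : Tendsto u atTop (𝓝[>] 0))
    (hμ : ∀ ω, Tendsto (fun n => ell (odot (u n)) ω) atTop (𝓝 (ell μ ω)))
    (E : Set (Chirotope ι)) :
    Measure.pi (fun _ : ι => μ) {x | chir area x ∈ E} =
      Measure.pi (fun _ : ι => modelMeasure) {w | chir limArea w ∈ E} := by
  classical
  have hlim : ∀ c : Chirotope ι, Tendsto (fun n =>
      (Measure.pi (fun _ : ι => odot (u n))).real {x | chir area x = c}) atTop
      (𝓝 ((Measure.pi (fun _ : ι => modelMeasure)).real {w | chir limArea w = c})) := fun c =>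
    (ENNReal.tendsto_toReal (measure_ne_top _ _)).comp (tendsto_pi_odot_chir {c} hu)
  have hgen : ∀ c : Chirotope ι, c.Generic →
      (Measure.pi (fun _ : ι => μ)).real {x | chir area x = c} =
        (Measure.pi (fun _ : ι => modelMeasure)).real {w | chir limArea w = c} := by
    intro c hc
    -- A realizable `c` is handled through its order type, cancelling the orbit size. An
    -- unrealizable one has probability `0` for `μ` and along the sequence, hence also in the model.
    by_cases hr : ∃ y : ι → Plane, chir area y = c
    · obtain ⟨y, rfl⟩ := hr
      have h := hμ (orderType hc)
      simp only [ell_orderType hι hc] at h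
      have h2 := tendsto_nhds_unique h ((hlim _).const_mul _)
      exact mul_left_cancel₀ (by exact_mod_cast (card_orbit_pos _).ne') h2
    · have he : {x : ι → Plane | chir area x = c} = ∅ := by
        ext x
        simpa using fun h => hr ⟨x, h⟩
      have h := hlim c
      simp only [he, measureReal_empty] at h ⊢
      exact tendsto_nhds_unique tendsto_const_nhds h
  have hsum : ∀ {α : Type _} [MeasurableSpace α] {D : α → α → α → ℝ}
      (_ : Measurable fun a : α × α × α => D a.1 a.2.1 a.2.2) (ν : Measure α)
      [IsProbabilityMeasure ν] (s : Finset (Chirotope ι)),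
      (Measure.pi (fun _ : ι => ν)).real {w | chir D w ∈ s} =
        ∑ c ∈ s, (Measure.pi (fun _ : ι => ν)).real {w | chir D w = c} := by
    intro α _ D hD ν _ s
    rw [← measureReal_biUnion_finset]
    · congr 1
      ext w
      simp
    · intro c _ c' _ hne
      exact Set.disjoint_left.2 fun w h h' => hne (Eq.trans (Eq.symm h) h')
    · exact fun c _ => measurableSet_chir_mem hD {c}
  -- Generic chirotopes carry the whole mass in the model, hence also for `μ` by `hgen`. No mass is
  -- left for degenerate samples, on which `ell` gives no direct information.
  have hgood : ∀ᵐ x ∂(Measure.pi fun _ : ι => μ), (chir area x).Generic := by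
    obtain ⟨G, hG⟩ : ∃ G : Finset (Chirotope ι), ∀ c, c ∈ G ↔ c.Generic :=
      ⟨Finset.univ.filter fun c => c.Generic, by simp⟩
    have h0 : {w : ι → Model | chir limArea w ∈ G} ∈ ae (Measure.pi fun _ : ι => modelMeasure) := by
      filter_upwards [ae_generic] with w hw
      exact (hG _).2 hw
    have h0' : Measure.pi (fun _ : ι => modelMeasure) {w | chir limArea w ∈ G} = 1 :=
      (mem_ae_iff_prob_eq_one
        (measurableSet_chir_mem measurable_limArea (G : Set (Chirotope ι)))).1 h0
    have h1 : (Measure.pi (fun _ : ι => μ)).real {x | chir area x ∈ G} = 1 := by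
      rw [hsum measurable_area, Finset.sum_congr rfl fun c hc => hgen c ((hG c).1 hc),
        ← hsum measurable_limArea, measureReal_def, h0']
      simp
    have h2 : {x : ι → Plane | chir area x ∈ G} ∈ ae (Measure.pi fun _ : ι => μ) :=
      (mem_ae_iff_prob_eq_one (measurableSet_chir_mem measurable_area
        (G : Set (Chirotope ι)))).2 ((ENNReal.toReal_eq_one_iff _).1 h1)
    filter_upwards [h2] with x hx
    exact (hG _).1 hx
  have hE : ∀ {α : Type _} [MeasurableSpace α] {D : α → α → α → ℝ} (ν : Measure α)
      [IsProbabilityMeasure ν], (∀ᵐ x ∂(Measure.pi fun _ : ι => ν), (chir D x).Generic) →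
      Measure.pi (fun _ : ι => ν) {w | chir D w ∈ E} = Measure.pi (fun _ : ι => ν) {w | chir D w ∈
        (Finset.univ.filter fun c : Chirotope ι => c.Generic ∧ c ∈ E)} := by
    intro α _ D ν _ h
    refine measure_congr ?_
    filter_upwards [h] with x hx
    refine propext ?_
    change chir D x ∈ E ↔ chir D x ∈ _
    simp [hx]
  rw [hE μ hgood, hE modelMeasure ae_generic,
    ← ENNReal.toReal_eq_toReal_iff' (measure_ne_top _ _) (measure_ne_top _ _)]
  refine (hsum measurable_area μ _).trans (Eq.trans ?_ (hsum measurable_limArea modelMeasure _).symm)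
  exact Finset.sum_congr rfl fun c hc => hgen c (Finset.mem_filter.1 hc).2.1

end

/-! ### Points inside triangles determine labels -/

/-- The point `i` lies in the interior of the triangle `abd`. -/
def Chirotope.InTriangle {ι : Type*} (c : Chirotope ι) (i a b d : ι) : Prop :=
  c a b i ≠ 0 ∧ c b d i = c a b i ∧ c d a i = c a b i

theorem sign_eq_sign_of_pos {x y : ℝ} (hx : 0 < x) (h : SignType.sign y = SignType.sign x) :
    0 < y := sign_eq_one_iff.1 (h.trans (sign_pos hx))

theorem sign_eq_sign_of_neg {x y : ℝ} (hx : x < 0) (h : SignType.sign y = SignType.sign x) :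
    y < 0 := sign_eq_neg_one_iff.1 (h.trans (sign_neg hx))

theorem signs_of_inTriangle {α ι : Type*} {D : α → α → α → ℝ} {w : ι → α} {i a b d : ι}
    (h : (chir D w).InTriangle i a b d) :
    (0 < D (w a) (w b) (w i) ∧ 0 < D (w b) (w d) (w i) ∧ 0 < D (w d) (w a) (w i)) ∨
    (D (w a) (w b) (w i) < 0 ∧ D (w b) (w d) (w i) < 0 ∧ D (w d) (w a) (w i) < 0) := by
  obtain ⟨h0, h1, h2⟩ := h
  rcases lt_or_gt_of_ne (sign_ne_zero.1 h0) with h | h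
  · exact Or.inr ⟨h, sign_eq_sign_of_neg h h1, sign_eq_sign_of_neg h h2⟩
  · exact Or.inl ⟨h, sign_eq_sign_of_pos h h1, sign_eq_sign_of_pos h h2⟩

theorem inTriangle_of_pos {α ι : Type*} {D : α → α → α → ℝ} {w : ι → α} {i a b d : ι}
    (h : 0 < D (w a) (w b) (w i)) (h1 : 0 < D (w b) (w d) (w i)) (h2 : 0 < D (w d) (w a) (w i)) :
    (chir D w).InTriangle i a b d := by
  simp [Chirotope.InTriangle, chir, sign_pos, *]

theorem inTriangle_of_neg {α ι : Type*} {D : α → α → α → ℝ} {w : ι → α} {i a b d : ι}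
    (h : D (w a) (w b) (w i) < 0) (h1 : D (w b) (w d) (w i) < 0) (h2 : D (w d) (w a) (w i) < 0) :
    (chir D w).InTriangle i a b d := by
  simp [Chirotope.InTriangle, chir, sign_neg, *]

/-- The squared distance to the origin. -/
def normSq (p : Plane) : ℝ := p 0 ^ 2 + p 1 ^ 2

theorem sq_add_sq_eq_zero {u v : ℝ} (h : u ^ 2 + v ^ 2 = 0) : u = 0 ∧ v = 0 := by
  constructor <;> nlinarith [sq_nonneg u, sq_nonneg v]

/-- The variance identity for a barycenter `(X, Y)` of three points with weights `l`. -/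
theorem barycenter_variance {l₁ l₂ l₃ X Y a a' b b' d d' : ℝ}
    (hX : (l₁ + l₂ + l₃) * X = l₁ * a + l₂ * b + l₃ * d)
    (hY : (l₁ + l₂ + l₃) * Y = l₁ * a' + l₂ * b' + l₃ * d') :
    l₁ * l₂ * ((a - b) ^ 2 + (a' - b') ^ 2) + l₁ * l₃ * ((a - d) ^ 2 + (a' - d') ^ 2) +
      l₂ * l₃ * ((b - d) ^ 2 + (b' - d') ^ 2) =
    (l₁ ^ 2 + l₁ * l₂ + l₁ * l₃) * (a ^ 2 + a' ^ 2 - (X ^ 2 + Y ^ 2)) +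
      (l₂ ^ 2 + l₁ * l₂ + l₂ * l₃) * (b ^ 2 + b' ^ 2 - (X ^ 2 + Y ^ 2)) +
      (l₃ ^ 2 + l₁ * l₃ + l₂ * l₃) * (d ^ 2 + d' ^ 2 - (X ^ 2 + Y ^ 2)) := by
  linear_combination ((l₁ + l₂ + l₃) * X + (l₁ * a + l₂ * b + l₃ * d)) * hX +
    ((l₁ + l₂ + l₃) * Y + (l₁ * a' + l₂ * b' + l₃ * d')) * hY

/-- A point inside a triangle is closer to the origin than some vertex. -/
theorem exists_normSq_lt {a b d p : Plane}
    (h : (0 < area a b p ∧ 0 < area b d p ∧ 0 < area d a p) ∨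
      (area a b p < 0 ∧ area b d p < 0 ∧ area d a p < 0)) :
    normSq p < normSq a ∨ normSq p < normSq b ∨ normSq p < normSq d := by
  by_contra! hle
  obtain ⟨ha, hb, hd⟩ := hle
  -- Unnormalised barycentric coordinates of `p`. They share a sign, so their pairwise products are
  -- positive in either orientation; the weighted variance is then positive, whereas `hle` would
  -- make it nonpositive.
  obtain ⟨l₃, h₃⟩ : ∃ l, l = area a b p := ⟨_, rfl⟩
  obtain ⟨l₁, h₁⟩ : ∃ l, l = area b d p := ⟨_, rfl⟩
  obtain ⟨l₂, h₂⟩ : ∃ l, l = area d a p := ⟨_, rfl⟩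
  have hX : (l₁ + l₂ + l₃) * p 0 = l₁ * a 0 + l₂ * b 0 + l₃ * d 0 := by
    rw [h₁, h₂, h₃]; simp only [area]; ring
  have hY : (l₁ + l₂ + l₃) * p 1 = l₁ * a 1 + l₂ * b 1 + l₃ * d 1 := by
    rw [h₁, h₂, h₃]; simp only [area]; ring
  have hab : (a 0 - b 0) ^ 2 + (a 1 - b 1) ^ 2 ≠ 0 := by
    intro h0
    obtain ⟨hx, hy⟩ := sq_add_sq_eq_zero h0
    have : area a b p = 0 := by
      simp only [area]
      linear_combination (p 0 - a 0) * hy - (p 1 - a 1) * hx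
    rcases h with h | h
    · exact h.1.ne' this
    · exact h.1.ne this
  rw [← h₁, ← h₂, ← h₃] at h
  have hpos : 0 < l₁ * l₂ ∧ 0 < l₁ * l₃ ∧ 0 < l₂ * l₃ := by
    rcases h with h | h
    · exact ⟨mul_pos h.2.1 h.2.2, mul_pos h.2.1 h.1, mul_pos h.2.2 h.1⟩
    · exact ⟨mul_pos_of_neg_of_neg h.2.1 h.2.2, mul_pos_of_neg_of_neg h.2.1 h.1,
        mul_pos_of_neg_of_neg h.2.2 h.1⟩
  have key := barycenter_variance hX hY
  have hab' : 0 < (a 0 - b 0) ^ 2 + (a 1 - b 1) ^ 2 :=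
    lt_of_le_of_ne (add_nonneg (sq_nonneg _) (sq_nonneg _)) hab.symm
  have e1 := mul_pos hpos.1 hab'
  have e2 := mul_nonneg hpos.2.1.le (add_nonneg (sq_nonneg (a 0 - d 0)) (sq_nonneg (a 1 - d 1)))
  have e3 := mul_nonneg hpos.2.2.le (add_nonneg (sq_nonneg (b 0 - d 0)) (sq_nonneg (b 1 - d 1)))
  have f1 := mul_nonpos_of_nonneg_of_nonpos
    (add_nonneg (add_nonneg (sq_nonneg l₁) hpos.1.le) hpos.2.1.le) (sub_nonpos.2 ha)
  have f2 := mul_nonpos_of_nonneg_of_nonpos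
    (add_nonneg (add_nonneg (sq_nonneg l₂) hpos.1.le) hpos.2.2.le) (sub_nonpos.2 hb)
  have f3 := mul_nonpos_of_nonneg_of_nonpos
    (add_nonneg (add_nonneg (sq_nonneg l₃) hpos.2.1.le) hpos.2.2.le) (sub_nonpos.2 hd)
  simp only [normSq] at f1 f2 f3
  linarith

theorem normSq_emb (t : ℝ) (a : Model) : normSq (emb t a) = radius t a.1 ^ 2 := by
  have := ux_sq_add_uy_sq a.2
  simp only [normSq, emb, PiLp.toLp_apply, Matrix.cons_val_zero, Matrix.cons_val_one]
  linear_combination radius t a.1 ^ 2 * this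

theorem labels_of_normSq_lt {t : ℝ} (h0 : 0 < t) (h1 : t < 1) {a b : Model}
    (h : normSq (emb t a) < normSq (emb t b)) : a.1 = false ∧ b.1 = true := by
  rw [normSq_emb, normSq_emb] at h
  obtain ⟨a, θ⟩ := a
  obtain ⟨b, φ⟩ := b
  cases a <;> cases b <;> simp [radius] at h ⊢
  rw [abs_of_pos h0] at h
  linarith

/-- In the limit model, a point inside a triangle is an inner point, and some vertex of the
triangle is an outer point. -/
theorem labels_of_inTriangle {ι : Type*} [Finite ι] {w : ι → Model}
    (hw : (chir limArea w).Generic) {i a b d : ι} (h : (chir limArea w).InTriangle i a b d) :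
    (w i).1 = false ∧ ((w a).1 = true ∨ (w b).1 = true ∨ (w d).1 = true) := by
  have hlt : ∀ᶠ t in 𝓝[>] (0 : ℝ), t < 1 := nhdsWithin_le_nhds (gt_mem_nhds one_pos)
  have hpos : ∀ᶠ t in 𝓝[>] (0 : ℝ), 0 < t := self_mem_nhdsWithin
  obtain ⟨t, ht, h1, h0⟩ := ((eventually_chir_emb hw).and (hlt.and hpos)).exists
  -- For this small `t` the triangle is a genuine one with vertices on the two circles, so norms can
  -- be compared.
  rw [← ht] at h
  rcases exists_normSq_lt (signs_of_inTriangle h) with h | h | h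
  · have := labels_of_normSq_lt h0 h1 h
    exact ⟨this.1, Or.inl this.2⟩
  · have := labels_of_normSq_lt h0 h1 h
    exact ⟨this.1, Or.inr (Or.inl this.2)⟩
  · have := labels_of_normSq_lt h0 h1 h
    exact ⟨this.1, Or.inr (Or.inr this.2)⟩

/-! ### The extension property of the limit model -/

/-- Configurations `a, b, c, p, q, s; x, y` such that `q` and `s` are inside the triangle `abc`
and `p` is inside the triangles `xqs` and `yqs`. -/
def baseEvent : Set (Chirotope (Fin 6 ⊕ Fin 2)) :=
  {c | c.InTriangle (.inl 4) (.inl 0) (.inl 1) (.inl 2) ∧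
    c.InTriangle (.inl 5) (.inl 0) (.inl 1) (.inl 2) ∧
    ∀ i : Fin 2, c.InTriangle (.inl 3) (.inr i) (.inl 4) (.inl 5)}

/-- Extensions by a point `z` such that `p` is inside the triangle `xyz`, and neither of the lines
`xz` and `yz` separates `p` from `q`. -/
def extensionEvent : Set (Chirotope ((Fin 6 ⊕ Fin 2) ⊕ Fin 1)) :=
  {c | c.InTriangle (.inl (.inl 3)) (.inl (.inr 0)) (.inl (.inr 1)) (.inr 0) ∧
    ∀ i : Fin 2, c (.inl (.inr i)) (.inr 0) (.inl (.inl 4)) =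
      c (.inl (.inr i)) (.inr 0) (.inl (.inl 3))}

theorem limArea_outer_outer_inner {a b c : Model} (ha : a.1 = true) (hb : b.1 = true)
    (hc : c.1 = false) : limArea a b c = cr a.2 b.2 := by
  simp [limArea, leadingCoeff, ha, hb, hc]

/-- Being inside triangles makes `p`, `q`, `s` inner points, so `x` and `y`, as the only possible
outer vertices, are outer. The orientation of two outer points and an inner one ignores the position
of the inner one, so it suffices that `z` be outer and that `xyz` surround the origin. -/
theorem model_extension :
    ∀ᵐ w ∂(Measure.pi fun _ : Fin 6 ⊕ Fin 2 => modelMeasure), chir limArea w ∈ baseEvent →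
      modelMeasure {a | chir limArea (Sum.elim w fun _ => a) ∈ extensionEvent} ≠ 0 := by
  filter_upwards [ae_generic] with w hw hbase
  obtain ⟨hq, hs, hp⟩ := hbase
  have hq := (labels_of_inTriangle hw hq).1
  have hs := (labels_of_inTriangle hw hs).1
  have hp' := (labels_of_inTriangle hw (hp 0)).1
  have hout : ∀ i : Fin 2, (w (.inr i)).1 = true := fun i => by
    have := (labels_of_inTriangle hw (hp i)).2
    simpa [hq, hs] using this
  have hne : cr (w (.inr 0)).2 (w (.inr 1)).2 ≠ 0 := by
    rw [← limArea_outer_outer_inner (hout 0) (hout 1) hp']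
    exact sign_ne_zero.1 (hw _ _ _ (by simp) (by simp) (by simp))
  set θ := (w (.inr 0)).2 with hθ
  set φ := (w (.inr 1)).2 with hφ
  -- The direction opposite to the sum of the two unit vectors puts the origin inside the triangle.
  -- The conditions on `z` are open, so a neighbourhood of `ψ` also works.
  obtain ⟨ψ, r, hr, h1, h2⟩ := exists_polar (u := -(ux θ + ux φ)) (v := -(uy θ + uy φ)) (by
    by_contra! h
    apply hne
    simp only [cr]
    linear_combination -uy φ * h.1 + ux φ * h.2)
  have hc : Continuous fun a : Ang × Ang => cr a.1 a.2 := by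
    have := continuous_ux
    have := continuous_uy
    unfold cr
    fun_prop
  have hopen : IsOpen {a : Model | a.1 = true ∧ 0 < cr θ φ * cr φ a.2 ∧ 0 < cr θ φ * cr a.2 θ} := by
    have o1 : IsOpen {a : Model | a.1 = true} := (isOpen_discrete {true}).preimage continuous_fst
    have c1 : Continuous fun a : Model => cr θ φ * cr φ a.2 :=
      continuous_const.mul (hc.comp (continuous_const.prodMk continuous_snd))
    have c2 : Continuous fun a : Model => cr θ φ * cr a.2 θ :=
      continuous_const.mul (hc.comp (continuous_snd.prodMk continuous_const))
    exact o1.inter ((isOpen_lt continuous_const c1).inter (isOpen_lt continuous_const c2))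
  have hψ : (true, ψ) ∈
      {a : Model | a.1 = true ∧ 0 < cr θ φ * cr φ a.2 ∧ 0 < cr θ φ * cr a.2 θ} := by
    have e1 : cr θ φ = r * cr φ ψ := by
      simp only [cr]; linear_combination -ux φ * h2 + uy φ * h1
    have e2 : cr θ φ = r * cr ψ θ := by
      simp only [cr]; linear_combination ux θ * h2 - uy θ * h1
    have hsq : 0 < cr θ φ * cr θ φ := mul_self_pos.2 hne
    refine ⟨rfl, ?_, ?_⟩
    · refine pos_of_mul_pos_right (a := r) ?_ hr.le
      calc 0 < cr θ φ * cr θ φ := hsq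
        _ = cr θ φ * (r * cr φ ψ) := by rw [← e1]
        _ = r * (cr θ φ * cr φ ψ) := by ring
    · refine pos_of_mul_pos_right (a := r) ?_ hr.le
      calc 0 < cr θ φ * cr θ φ := hsq
        _ = cr θ φ * (r * cr ψ θ) := by rw [← e2]
        _ = r * (cr θ φ * cr ψ θ) := by ring
  refine fun h0 => (hopen.measure_ne_zero modelMeasure ⟨_, hψ⟩) (measure_mono_null ?_ h0)
  rintro z ⟨hz, hz1, hz2⟩
  have l1 := limArea_outer_outer_inner (hout 0) (hout 1) hp'
  have l2 := limArea_outer_outer_inner (hout 1) hz hp'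
  have l3 := limArea_outer_outer_inner hz (hout 0) hp'
  rw [← hθ, ← hφ] at l1
  rw [← hφ] at l2
  rw [← hθ] at l3
  refine ⟨?_, fun i => ?_⟩
  · rcases lt_or_gt_of_ne hne with h | h
    · refine inTriangle_of_neg ?_ ?_ ?_
      · change limArea (w (.inr 0)) (w (.inr 1)) (w (.inl 3)) < 0
        rwa [l1]
      · change limArea (w (.inr 1)) z (w (.inl 3)) < 0
        rw [l2]; exact neg_of_mul_pos_right hz1 h.le
      · change limArea z (w (.inr 0)) (w (.inl 3)) < 0
        rw [l3]; exact neg_of_mul_pos_right hz2 h.le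
    · refine inTriangle_of_pos ?_ ?_ ?_
      · change 0 < limArea (w (.inr 0)) (w (.inr 1)) (w (.inl 3))
        rwa [l1]
      · change 0 < limArea (w (.inr 1)) z (w (.inl 3))
        rw [l2]; exact pos_of_mul_pos_right hz1 h.le
      · change 0 < limArea z (w (.inr 0)) (w (.inl 3))
        rw [l3]; exact pos_of_mul_pos_right hz2 h.le
  · change SignType.sign (limArea (w (.inr i)) z (w (.inl 4))) =
      SignType.sign (limArea (w (.inr i)) z (w (.inl 3)))
    rw [limArea_outer_outer_inner (hout i) hz hq, limArea_outer_outer_inner (hout i) hz hp']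

theorem model_baseEvent_ne_zero :
    Measure.pi (fun _ : Fin 6 ⊕ Fin 2 => modelMeasure) {w | chir limArea w ∈ baseEvent} ≠ 0 := by
  obtain ⟨north, hn, hn'⟩ := exists_ang (u := 0) (v := 1) (by norm_num)
  obtain ⟨east, he, he'⟩ := exists_ang (u := 1) (v := 0) (by norm_num)
  obtain ⟨west, hw, hw'⟩ := exists_ang (u := -1) (v := 0) (by norm_num)
  obtain ⟨sw, hsw, hsw'⟩ := exists_ang (u := -4 / 5) (v := -3 / 5) (by norm_num)
  obtain ⟨se, hse, hse'⟩ := exists_ang (u := 4 / 5) (v := -3 / 5) (by norm_num)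
  -- An explicit configuration with rational coordinates. That `x`, `y` and `a` coincide is
  -- harmless: only strict inequalities not comparing these points are needed, and these persist
  -- nearby.
  let w₀ : Fin 6 ⊕ Fin 2 → Model := Sum.elim
    ![(true, north), (true, sw), (true, se), (false, north), (false, east), (false, west)]
    fun _ => (true, north)
  let tri (s : ℝ) (i a b d : Fin 6 ⊕ Fin 2) : Set (Fin 6 ⊕ Fin 2 → Model) :=
    {w | 0 < s * limArea (w a) (w b) (w i) ∧ 0 < s * limArea (w b) (w d) (w i) ∧
      0 < s * limArea (w d) (w a) (w i)}
  have hl : ∀ (s : ℝ) (a b d : Fin 6 ⊕ Fin 2),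
      IsOpen {w : Fin 6 ⊕ Fin 2 → Model | 0 < s * limArea (w a) (w b) (w d)} := fun s a b d => by
    have h : Continuous fun w : Fin 6 ⊕ Fin 2 → Model => (w a, w b, w d) := by fun_prop
    exact isOpen_lt continuous_const (continuous_const.mul (continuous_limArea.comp h))
  have htri : ∀ s i a b d, IsOpen (tri s i a b d) := fun s i a b d =>
    (hl _ _ _ _).inter ((hl _ _ _ _).inter (hl _ _ _ _))
  let U := tri 1 (.inl 4) (.inl 0) (.inl 1) (.inl 2) ∩ tri 1 (.inl 5) (.inl 0) (.inl 1) (.inl 2) ∩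
    ⋂ i : Fin 2, tri (-1) (.inl 3) (.inr i) (.inl 4) (.inl 5)
  have hU : IsOpen U := ((htri _ _ _ _ _).inter (htri _ _ _ _ _)).inter
    (isOpen_iInter_of_finite fun i => htri _ _ _ _ _)
  have hmem : w₀ ∈ U := by
    refine ⟨⟨⟨?_, ?_, ?_⟩, ⟨?_, ?_, ?_⟩⟩, Set.mem_iInter.2 fun i => ⟨?_, ?_, ?_⟩⟩ <;>
    · simp [w₀, limArea, leadingCoeff, cr, hn, hn', he, he', hw, hw', hsw, hsw', hse, hse']
      try norm_num
  have hpos : (Measure.pi fun _ : Fin 6 ⊕ Fin 2 => modelMeasure).IsOpenPosMeasure :=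
    Measure.pi.isOpenPosMeasure fun _ => modelMeasure
  refine fun h0 => hU.measure_ne_zero (Measure.pi fun _ : Fin 6 ⊕ Fin 2 => modelMeasure)
    ⟨w₀, hmem⟩ (measure_mono_null ?_ h0)
  rintro w ⟨⟨h1, h2⟩, h3⟩
  refine ⟨inTriangle_of_pos ?_ ?_ ?_, inTriangle_of_pos ?_ ?_ ?_, fun i => ?_⟩
  · linarith [h1.1]
  · linarith [h1.2.1]
  · linarith [h1.2.2]
  · linarith [h2.1]
  · linarith [h2.2.1]
  · linarith [h2.2.2]
  · have h4 := Set.mem_iInter.1 h3 i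
    refine inTriangle_of_neg ?_ ?_ ?_
    · linarith [h4.1]
    · linarith [h4.2.1]
    · linarith [h4.2.2]

/-! ### Obstruction in the plane -/

/-- The points `x` such that the direction `r` lies in the open cone spanned by the vectors
from `x` to `p` and `q`. -/
def coneSet (p q r : Plane) : Set Plane :=
  {x | 0 < area x p q * ((p 0 - x 0) * r 1 - (p 1 - x 1) * r 0) ∧
    0 < area x p q * (r 0 * (q 1 - x 1) - r 1 * (q 0 - x 0))}

theorem exists_mem_coneSet {s : Set Plane} (hs : Dense s) {p q x : Plane}
    (h : area x p q ≠ 0) : ∃ r ∈ s, x ∈ coneSet p q r := by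
  have hopen : IsOpen {r : Plane | x ∈ coneSet p q r} := by
    have c1 : Continuous fun r : Plane =>
        area x p q * ((p 0 - x 0) * r 1 - (p 1 - x 1) * r 0) := by fun_prop
    have c2 : Continuous fun r : Plane =>
        area x p q * (r 0 * (q 1 - x 1) - r 1 * (q 0 - x 0)) := by fun_prop
    exact (isOpen_lt continuous_const c1).inter (isOpen_lt continuous_const c2)
  -- The sum of the vectors from `x` to `p` and to `q` lies in the open cone, which is therefore
  -- nonempty.
  obtain ⟨r, hr, hrs⟩ := hs.inter_open_nonempty _ hopen ⟨(p - x) + (q - x), by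
    have hsq : 0 < area x p q * area x p q := mul_self_pos.2 h
    constructor
    · convert hsq using 2
      simp only [area, PiLp.add_apply, PiLp.sub_apply]
      ring
    · convert hsq using 2
      simp only [area, PiLp.add_apply, PiLp.sub_apply]
      ring⟩
  exact ⟨r, hrs, hr⟩

/-- `X`, `Y`, `W` are barycentric weights of `p` in `xyz`, and `hz` is the barycentric relation
crossed with `q - p`; `hh` is a Plücker relation. If `u, v < 0`, then `h1` gives `-v < X`, so `h * X
< -m * v < m * X < h * X`. If `u, v > 0`, then `h2` gives `u < X`, and the same chain with `m'` is
reversed. -/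
theorem cone_inequalities_false {X Y W u v zq h m m' : ℝ} (hX : 0 < X) (hY : 0 < Y) (hW : 0 < W)
    (hz : X * zq + Y * u + W * v = 0) (hh : h * X = m' * u - m * v) (huv : 0 < u * v)
    (hm : 0 < -u * m) (hhm : 0 < -u * (h - m)) (hm' : 0 < -v * m') (hhm' : 0 < -v * (h - m'))
    (h1 : -W + zq - u < 0) (h2 : 0 < Y + zq - v) : False := by
  rcases lt_trichotomy u 0 with hu | hu | hu
  · have hv : v < 0 := neg_of_mul_pos_right huv hu.le
    have m0 : 0 < m := pos_of_mul_pos_right hm (by linarith)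
    have hhm0 : 0 < h - m := pos_of_mul_pos_right hhm (by linarith)
    have m0' : 0 < m' := pos_of_mul_pos_right hm' (by linarith)
    have hXv : -v < X := by
      have e1 : X * (-W + zq - u) < 0 := mul_neg_of_pos_of_neg hX h1
      have e2 : 0 < W * (X + v) := by nlinarith [mul_pos hX (neg_pos.2 hu), mul_pos hY (neg_pos.2 hu)]
      have := pos_of_mul_pos_right e2 hW.le
      linarith
    nlinarith [mul_pos m0' (neg_pos.2 hu), mul_pos hhm0 (neg_pos.2 hv),
      mul_pos (add_pos hhm0 m0) (sub_pos.2 hXv)]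
  · simp [hu] at huv
  · have hv : 0 < v := pos_of_mul_pos_right huv hu.le
    have m0 : m < 0 := neg_of_mul_pos_right hm (by linarith)
    have m0' : m' < 0 := neg_of_mul_pos_right hm' (by linarith)
    have hhm0' : h - m' < 0 := neg_of_mul_pos_right hhm' (by linarith)
    have hXu : u < X := by
      have e1 : 0 < X * (Y + zq - v) := mul_pos hX h2
      have e2 : 0 < Y * (X - u) := by nlinarith [mul_pos hX hv, mul_pos hW hv]
      have := pos_of_mul_pos_right e2 hY.le
      linarith
    nlinarith [mul_pos (neg_pos.2 m0) hv, mul_pos (neg_pos.2 hhm0') hu,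
      mul_pos (neg_pos.2 (add_neg hhm0' m0')) (sub_pos.2 hXu)]

theorem coneSet_false_of_pos {p q r x y z : Plane} (hx : x ∈ coneSet p q r)
    (hy : y ∈ coneSet p q r) (hxy : 0 < area x q p * area y q p)
    (h1 : 0 < area x y p) (h2 : 0 < area y z p) (h3 : 0 < area z x p)
    (hxz : area x z q < 0) (hyz : 0 < area y z q) : False := by
  obtain ⟨hx1, hx2⟩ := hx
  obtain ⟨hy1, hy2⟩ := hy
  refine cone_inequalities_false (X := area x y p) (Y := area y z p) (W := area z x p)
    (u := area x q p) (v := area y q p) (zq := area p z q)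
    (h := r 0 * (q 1 - p 1) - r 1 * (q 0 - p 0))
    (m := (p 0 - x 0) * r 1 - (p 1 - x 1) * r 0) (m' := (p 0 - y 0) * r 1 - (p 1 - y 1) * r 0)
    h1 h2 h3 ?_ ?_ hxy ?_ ?_ ?_ ?_ ?_ ?_
  · simp only [area]; ring
  · simp only [area]; ring
  · convert hx1 using 1; simp only [area]; ring
  · convert hx2 using 1; simp only [area]; ring
  · convert hy1 using 1; simp only [area]; ring
  · convert hy2 using 1; simp only [area]; ring
  · convert hxz using 1; simp only [area]; ring
  · convert hyz using 1; simp only [area]; ring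

theorem area_swap (p q r : Plane) : area p q r = -area q p r := by
  simp only [area]; ring

/-- Suppose that `p` lies inside `xyz` and that neither of the lines `xz`, `yz` separates `p` from
`q`, where `x` and `y` lie on the same side of the line `pq`. Then the open cones spanned by `p`
and `q` from `x` and from `y` have no common direction. -/
theorem coneSet_false {ι : Type*} {w : ι → Plane} {p q x y z : ι} {r : Plane}
    (hx : w x ∈ coneSet (w p) (w q) r) (hy : w y ∈ coneSet (w p) (w q) r)
    (hxy : 0 < area (w x) (w q) (w p) * area (w y) (w q) (w p))
    (h : (chir area w).InTriangle p x y z) (hxz : chir area w x z q = chir area w x z p)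
    (hyz : chir area w y z q = chir area w y z p) : False := by
  have s1 := area_swap (w x) (w z) (w p)
  have s2 := area_swap (w y) (w z) (w p)
  rcases signs_of_inTriangle h with ⟨h1, h2, h3⟩ | ⟨h1, h2, h3⟩
  · exact coneSet_false_of_pos hx hy hxy h1 h2 h3 (sign_eq_sign_of_neg (by linarith) hxz)
      (sign_eq_sign_of_pos h2 hyz)
  · have s3 := area_swap (w x) (w y) (w p)
    -- Exchanging `x` and `y` reverses the orientation of the triangle.
    exact coneSet_false_of_pos hy hx (by linarith) (z := w z) (by linarith) (by linarith)
      (by linarith) (sign_eq_sign_of_neg (by linarith) hyz) (sign_eq_sign_of_pos (by linarith) hxz)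

/-- No probability measure on the plane has the same laws of chirotopes as the limit model. -/
theorem chir_law_ne_model (μ : Measure Plane) [IsProbabilityMeasure μ]
    (hlaw : ∀ (ι : Type) [Fintype ι], 3 ≤ Fintype.card ι → ∀ E : Set (Chirotope ι),
      Measure.pi (fun _ : ι => μ) {x | chir area x ∈ E} =
        Measure.pi (fun _ : ι => modelMeasure) {w | chir limArea w ∈ E}) : False := by
  have hext := pos_extension_of_law_eq measurable_limArea measurable_area modelMeasure μ
    (fun N E => hlaw ((Fin 6 ⊕ Fin 2) ⊕ Fin N) (by simp; omega) E) baseEvent extensionEvent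
    model_extension
  have hbase : Measure.pi (fun _ : Fin 6 ⊕ Fin 2 => μ) {x | chir area x ∈ baseEvent} ≠ 0 := by
    rw [hlaw _ (by simp)]
    exact model_baseEvent_ne_zero
  have hmp := measurePreserving_sumElim (ι := Fin 6) (κ := Fin 2) μ
  have hm := measurableSet_chir_mem measurable_area baseEvent
  have hae := Measure.ae_ae_of_ae_prod (hmp.quasiMeasurePreserving.ae hext)
  -- Fubini: `a, b, c, p, q, s` can be frozen so that `x` and `y` remain independent samples from
  -- `μ`.
  have hex : ∃ w : Fin 6 → Plane, (Measure.pi fun _ : Fin 2 => μ)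
      {v | chir area (Sum.elim w v) ∈ baseEvent} ≠ 0 ∧
      ∀ᵐ v ∂(Measure.pi fun _ : Fin 2 => μ), chir area (Sum.elim w v) ∈ baseEvent →
        μ {b | chir area (Sum.elim (Sum.elim w v) fun _ => b) ∈ extensionEvent} ≠ 0 := by
    by_contra hno
    refine hbase ?_
    rw [← hmp.measure_preimage hm.nullMeasurableSet, Measure.measure_prod_null (hmp.measurable hm)]
    filter_upwards [hae] with w hw
    by_contra h0
    exact hno ⟨w, h0, hw⟩
  obtain ⟨w, hw, hwae⟩ := hex
  let A : Set Plane := {x | (chir area (Sum.elim w fun _ : Fin 1 => x)).InTriangle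
    (.inl 3) (.inr 0) (.inl 4) (.inl 5)}
  let C : ℕ → Set Plane := fun n => A ∩ coneSet (w 3) (w 4) (TopologicalSpace.denseSeq Plane n)
  have hAC : A ⊆ ⋃ n, C n := by
    intro x hx
    have hne : area x (w 3) (w 4) ≠ 0 := by
      have h0 : area x (w 4) (w 3) ≠ 0 := sign_ne_zero.1 hx.1
      intro h
      apply h0
      simp only [area] at h ⊢
      linarith
    obtain ⟨_, ⟨n, rfl⟩, hr⟩ := exists_mem_coneSet (TopologicalSpace.denseRange_denseSeq Plane) hne
    exact Set.mem_iUnion.2 ⟨n, hx, hr⟩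
  have hAne : μ A ≠ 0 := by
    intro h0
    refine hw (measure_mono_null (t := Set.univ.pi fun _ : Fin 2 => A) ?_ ?_)
    · intro v hv i _
      exact hv.2.2 i
    · rw [Measure.pi_pi]
      simp [h0]
  obtain ⟨n, hn⟩ : ∃ n, μ (C n) ≠ 0 := by
    by_contra! h
    exact hAne (measure_mono_null hAC (measure_iUnion_null h))
  obtain ⟨v₀, hv₀⟩ := nonempty_of_measure_ne_zero hw
  have hpi : (Measure.pi fun _ : Fin 2 => μ) (Set.univ.pi fun _ => C n) ≠ 0 := by
    rw [Measure.pi_pi]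
    simp [hn]
  obtain ⟨v, hv, hvC⟩ : ∃ v : Fin 2 → Plane, (chir area (Sum.elim w v) ∈ baseEvent →
      μ {b | chir area (Sum.elim (Sum.elim w v) fun _ => b) ∈ extensionEvent} ≠ 0) ∧
      ∀ i, v i ∈ C n := by
    -- The product of two copies of `C n` has positive measure, so it meets the almost sure set;
    -- both `x` and `y` then see the same direction between `p` and `q`.
    by_contra! hno
    refine hpi (measure_mono_null ?_ (ae_iff.1 hwae))
    intro v hv h
    obtain ⟨i, hi⟩ := hno v h
    exact hi (hv i trivial)
  -- The conditions on `q` and `s` involve only `w`, so they are inherited from `v₀`.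
  have hvbase : chir area (Sum.elim w v) ∈ baseEvent :=
    ⟨hv₀.1, hv₀.2.1, fun i => (hvC i).1⟩
  obtain ⟨z, hz, hzi⟩ := nonempty_of_measure_ne_zero (hv hvbase)
  refine coneSet_false (w := (Sum.elim (Sum.elim w v) fun _ => z : (Fin 6 ⊕ Fin 2) ⊕ Fin 1 → Plane))
    (p := .inl (.inl 3)) (q := .inl (.inl 4)) (x := .inl (.inr 0)) (y := .inl (.inr 1)) (z := .inr 0)
    (hvC 0).2 (hvC 1).2 ?_ hz (hzi 0) (hzi 1)
  have hside : SignType.sign (area (v 0) (w 4) (w 3)) = SignType.sign (area (v 1) (w 4) (w 3)) :=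
    (hvC 0).1.2.1.symm.trans (hvC 1).1.2.1
  have hne : area (v 1) (w 4) (w 3) ≠ 0 := sign_ne_zero.1 (hvC 1).1.1
  change 0 < area (v 0) (w 4) (w 3) * area (v 1) (w 4) (w 3)
  rcases lt_or_gt_of_ne hne with h | h
  · exact mul_pos_of_neg_of_neg (sign_eq_sign_of_neg h hside) h
  · exact mul_pos (sign_eq_sign_of_pos h hside) h

end PlanarOrder

theorem propositiont :
    (∃ l : PlanarOrder.OType → ℝ, PlanarOrder.IsOdotLimit l) ∧
      ∀ l : PlanarOrder.OType → ℝ, PlanarOrder.IsOdotLimit l →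
        ¬ ∃ μ : MeasureTheory.Measure PlanarOrder.Plane,
          MeasureTheory.IsProbabilityMeasure μ ∧ PlanarOrder.ell μ = l := by
  constructor
  · obtain ⟨l, φ, hφ, hl⟩ := PlanarOrder.exists_subseq_tendsto_ell
      -- The shift by `2` keeps the indices in the range `n ≥ 2`.
      fun n => PlanarOrder.odot (1 / ((n + 2 : ℕ) : ℝ))
    exact ⟨l, fun k => φ k + 2, fun a b hab => Nat.add_lt_add_right (hφ hab) 2,
      fun k => Nat.le_add_left 2 _, hl⟩
  · rintro l ⟨φ, hφ, -, hl⟩ ⟨μ, hμ, rfl⟩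
    have hu : Tendsto (fun k => 1 / (φ k : ℝ)) atTop (𝓝[>] 0) := by
      have h := (tendsto_inv_atTop_nhdsGT_zero (𝕜 := ℝ)).comp
        (tendsto_natCast_atTop_atTop.comp hφ.tendsto_atTop)
      simpa [Function.comp_def, one_div] using h
    exact PlanarOrder.chir_law_ne_model μ fun ι _ hι E =>
      PlanarOrder.pi_chir_eq_model hι μ hu hl E
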